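/- (State-space collapse under MaxWeight.) Let $n\ge 1$ and consider an $n\times n$ input-queued switch in discrete time. Its queue lengths $q(t)=(q_{ij}(t))\in\mathbb{Z}_{\ge 0}^{n\times n}$ evolve by $q_{ij}(t+1)=[q_{ij}(t)+a_{ij}(t)-s_{ij}(t)]^+$. The schedule $s(t)$ is chosen, given $q(t)$, by the MaxWeight algorithm: it maximizes $\sum_{ij}q_{ij}(t)s_{ij}$ over all $0$-$1$ matrices $s$ with all row and column sums at most $1$; ties are broken by any (possibly randomized) rule depending on $q(t)$, for instance uniformly at random. Let $\nu\in\mathbb{R}_{\ge0}^{n\times n}$ have all row and column sums equal to $1$, with $\nu_{\min}=\min_{ij}\nu_{ij}>0$, and let $a_{\max}\ge 1$. For each $0<\epsilon<1$ consider such a switch whose arrivals $a^{(\epsilon)}_{ij}(t)\in\mathbb{Z}_{\ge 0}$ are i.i.d. over $t$, independent over $(i,j)$, independent of the past and of the schedule chosen in slot $t$, bounded by $a_{\max}$, equal to $0$ with positive probability, and have means $\lambda^{(\epsilon)}=(1-\epsilon)\nu$ and variances $(\sigma_{ij}^{(\epsilon)})^2$. Let $\|\cdot\|$ be the Euclidean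 norm on $\mathbb{R}^{n\times n}$, let $K=\{x: x_{ij}=w_i+\tilde w_j \text{ for some } w_i,\tilde w_j\ge 0\}$ be the cone spanned by the row and the column indicator matrices, let $x_\parallel$ be the closest point to $x$ in $K$, and let $x_\perp=x-x_\parallel$. Then for every $0<\epsilon<1$ the Markov chain $q^{(\epsilon)}(t)$ has a stationary distribution, to which it converges in distribution from every initial distribution; let $\bar q^{(\epsilon)}$ be a random vector with this distribution. If $0<\epsilon\le \nu_{\min}/(2\|\nu\|)$, then for all $r\in\{1,2,\dots\}$ $$\mathbb{E}\big[\|\bar q^{(\epsilon)}_\perp\|^r\big]\le (M_r^{(\epsilon)})^r,\qquad M_r^{(\epsilon)}=2^{1/r}\max\Big(\frac{8(\|\lambda^{(\epsilon)}\|^2+\|\sigma^{(\epsilon)}\|^2+n)}{\nu_{\min}},\ (\sqrt r\,e)^{1/r}\,16\,\frac re\,\frac{n a_{\max}}{\nu_{\min}}\,(n a_{\max}+1)\Big).$$ Moreover, for each $r$, $M_r^{(\epsilon)}$ is bounded over $0<\epsilon\le\nu_{\min}/(2\|\nu\|)$ by a constant that does not depend on $\epsilon$. -/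

import Mathlib

open MeasureTheory ProbabilityTheory Filter Topology

namespace InputQueuedSwitch

noncomputable section

/-- The Euclidean space of real `n × n` arrays, with inner product `∑ᵢⱼ xᵢⱼ yᵢⱼ`. -/
abbrev Vec (n : ℕ) : Type := EuclideanSpace ℝ (Fin n × Fin n)

/-- Integer `n × n` arrays: queue lengths, numbers of arrivals, and schedules. The entry `(i, j)`
belongs to input port `i` and output port `j`. -/
abbrev Arr (n : ℕ) : Type := Fin n × Fin n → ℕ

/-- An integer array, viewed as a real vector. -/
def toVec {n : ℕ} (q : Arr n) : Vec n := WithLp.toLp 2 fun p => (q p : ℝ)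

/-! ### Geometry -/

/-- `e⁽ⁱ⁾`: ones in row `i`, zeros elsewhere. -/
def rowVec {n : ℕ} (i : Fin n) : Vec n := WithLp.toLp 2 fun p => if p.1 = i then 1 else 0

/-- `ẽ⁽ʲ⁾`: ones in column `j`, zeros elsewhere. -/
def colVec {n : ℕ} (j : Fin n) : Vec n := WithLp.toLp 2 fun p => if p.2 = j then 1 else 0

/-- The face `F` of the capacity region on which every port is saturated: the nonnegative arrays
all of whose row sums and column sums are one. -/
def face (n : ℕ) : Set (Vec n) :=
  {x | (∀ p, 0 ≤ x p) ∧ (∀ i, ∑ j, x (i, j) = 1) ∧ ∀ j, ∑ i, x (i, j) = 1}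

/-- The cone `K` spanned by the row and the column indicators. -/
def cone (n : ℕ) : Set (Vec n) :=
  {x | ∃ w w' : Fin n → ℝ, (∀ i, 0 ≤ w i) ∧ (∀ j, 0 ≤ w' j) ∧
    x = ∑ i, w i • rowVec i + ∑ j, w' j • colVec j}

/-- The combination of the spanning vectors has the entries `wᵢ + w'ⱼ`. -/
lemma comb_apply {n : ℕ} (w w' : Fin n → ℝ) (p : Fin n × Fin n) :
    (∑ i, w i • rowVec i + ∑ j, w' j • colVec j : Vec n) p = w p.1 + w' p.2 := by
  simp [rowVec, colVec]

/-- Every vector has a closest point in the cone. -/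
lemma exists_closest {n : ℕ} (x : Vec n) :
    ∃ y ∈ cone n, ∀ z ∈ cone n, ‖x - y‖ ≤ ‖x - z‖ := by
  obtain ⟨L, hLdef⟩ : ∃ L : (Fin n → ℝ) × (Fin n → ℝ) → Vec n,
      ∀ u, L u = ∑ i, u.1 i • rowVec i + ∑ j, u.2 j • colVec j := ⟨_, fun _ => rfl⟩
  have hLapp : ∀ u p, L u p = u.1 p.1 + u.2 p.2 := fun u p => by
    rw [hLdef]; exact comb_apply _ _ _
  have hL : Continuous L := by
    rw [funext hLdef]; fun_prop
  have hL0 : L 0 = 0 := by simp [hLdef]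
  have hB : (0 : ℝ) ≤ 2 * ‖x‖ := by positivity
  obtain ⟨B, hBdef⟩ : ∃ B : ℝ, B = 2 * ‖x‖ := ⟨_, rfl⟩
  rw [← hBdef] at hB
  have hs : IsCompact ((Set.Icc 0 fun _ => B) ×ˢ (Set.Icc 0 fun _ => B) :
      Set ((Fin n → ℝ) × (Fin n → ℝ))) := isCompact_Icc.prod isCompact_Icc
  have h0 : (0 : (Fin n → ℝ) × (Fin n → ℝ)) ∈
      ((Set.Icc 0 fun _ => B) ×ˢ (Set.Icc 0 fun _ => B) :
        Set ((Fin n → ℝ) × (Fin n → ℝ))) :=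
    ⟨⟨le_refl _, fun _ => hB⟩, ⟨le_refl _, fun _ => hB⟩⟩
  have hcont : Continuous fun u => ‖x - L u‖ := (continuous_const.sub hL).norm
  obtain ⟨u, hu, hmin⟩ := hs.exists_isMinOn ⟨0, h0⟩ hcont.continuousOn
  have hz : ‖x - L u‖ ≤ ‖x‖ := by
    have h : ‖x - L u‖ ≤ ‖x - L 0‖ := hmin h0
    rwa [hL0, sub_zero] at h
  refine ⟨L u, ⟨u.1, u.2, hu.1.1, hu.2.1, hLdef u⟩, ?_⟩
  rintro z ⟨w, w', hw, hw', rfl⟩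
  rw [← hLdef (w, w')]
  have key : ∀ p : Fin n × Fin n, B < w p.1 + w' p.2 → ‖x - L u‖ ≤ ‖x - L (w, w')‖ := by
    intro p hp
    have h1 : ‖L (w, w') p‖ ≤ ‖L (w, w')‖ := PiLp.norm_apply_le _ p
    have h2 : w p.1 + w' p.2 ≤ ‖L (w, w')‖ := by
      rw [hLapp] at h1
      exact (Real.le_norm_self _).trans h1
    have h3 : ‖L (w, w')‖ ≤ ‖x‖ + ‖x - L (w, w')‖ := by
      have := norm_sub_le x (x - L (w, w'))
      rwa [sub_sub_cancel] at this
    linarith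
  by_contra hcon
  refine hcon (hmin ⟨⟨hw, fun i => ?_⟩, ⟨hw', fun j => ?_⟩⟩)
  · by_contra hi
    exact hcon (key (i, i) ((not_le.mp hi).trans_le (le_add_of_nonneg_right (hw' i))))
  · by_contra hj
    exact hcon (key (j, j) ((not_le.mp hj).trans_le (le_add_of_nonneg_left (hw j))))

/-- The projection `x_∥` of `x` onto the cone: its closest point in the cone. -/
def par {n : ℕ} (x : Vec n) : Vec n := (exists_closest x).choose

/-- `x_∥` lies in the cone and is at minimal distance from `x`. -/
lemma par_spec {n : ℕ} (x : Vec n) :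
    par x ∈ cone n ∧ ∀ z ∈ cone n, ‖x - par x‖ ≤ ‖x - z‖ :=
  (exists_closest x).choose_spec

/-- The component `x_⊥ = x - x_∥`. -/
def perp {n : ℕ} (x : Vec n) : Vec n := x - par x

/-- `min_{ij} νᵢⱼ`. -/
def minEntry {n : ℕ} (ν : Vec n) : ℝ := ⨅ p, ν p

/-! ### Arrivals -/

/-- `α p` is the law of the number of packets that arrive at queue `p` in one time slot. It is
bounded by `aMax`, and no arrival has positive probability. -/
def IsArrivalLaw {n : ℕ} (α : Fin n × Fin n → ProbabilityMeasure ℕ) (aMax : ℝ) : Prop :=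
  (∀ p, ∀ᵐ k : ℕ ∂(α p : Measure ℕ), (k : ℝ) ≤ aMax) ∧
    ∃ δ : ℝ, 0 < δ ∧ ∀ p, δ < (α p : Measure ℕ).real {0}

/-- The vector `λ` of mean arrival rates. -/
def arrivalMean {n : ℕ} (α : Fin n × Fin n → ProbabilityMeasure ℕ) : Vec n :=
  WithLp.toLp 2 fun p => ∫ k : ℕ, (k : ℝ) ∂(α p : Measure ℕ)

/-- The vector `σ` of the standard deviations of the arrivals. -/
def arrivalStd {n : ℕ} (α : Fin n × Fin n → ProbabilityMeasure ℕ) : Vec n :=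
  WithLp.toLp 2 fun p => √(variance (fun k : ℕ => (k : ℝ)) (α p : Measure ℕ))

/-- The law of the array of the arrivals in one time slot: independent over the queues. -/
def arrivalLaw {n : ℕ} (α : Fin n × Fin n → ProbabilityMeasure ℕ) : Measure (Arr n) :=
  Measure.pi fun p => (α p : Measure ℕ)

instance {n : ℕ} (α : Fin n × Fin n → ProbabilityMeasure ℕ) :
    IsProbabilityMeasure (arrivalLaw α) := by
  unfold arrivalLaw; infer_instance

/-! ### The MaxWeight algorithm -/

/-- The feasible schedules: the 0-1 arrays of the matchings between input and output ports. -/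
def schedules (n : ℕ) : Set (Arr n) :=
  {s | (∀ p, s p ≤ 1) ∧ (∀ i, ∑ j, s (i, j) ≤ 1) ∧ ∀ j, ∑ i, s (i, j) ≤ 1}

/-- `s` is a feasible schedule of maximal weight `∑ᵢⱼ qᵢⱼ sᵢⱼ`. -/
def IsMaxWeight {n : ℕ} (q s : Arr n) : Prop :=
  s ∈ schedules n ∧ ∀ s' ∈ schedules n, ∑ p, q p * s' p ≤ ∑ p, q p * s p

/-- A MaxWeight algorithm: `τ q` is the law of the schedule chosen when the queue lengths are `q`.
It is carried by the schedules of maximal weight. How ties are broken is left free: uniformly over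
all of them, uniformly over the perfect matchings among them, and so on. -/
def IsMaxWeightRule {n : ℕ} (τ : Arr n → ProbabilityMeasure (Arr n)) : Prop :=
  ∀ q, ∀ᵐ s ∂(τ q : Measure (Arr n)), IsMaxWeight q s

/-! ### The Markov chain of the queue lengths -/

/-- The queue lengths `[q + a - s]⁺` after one time slot with arrivals `a` and schedule `s`
(subtraction of natural numbers is truncated at zero). -/
def next {n : ℕ} (q a s : Arr n) : Arr n := fun p => q p + a p - s p

/-- The transition kernel of the queue lengths: the schedule is drawn from `τ q`, and the arrivals
are independent of it and of the past. -/
def transition {n : ℕ} (α : Fin n × Fin n → ProbabilityMeasure ℕ)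
    (τ : Arr n → ProbabilityMeasure (Arr n)) : Kernel (Arr n) (Arr n) :=
  Kernel.ofFunOfCountable fun q =>
    ((τ q : Measure (Arr n)).prod (arrivalLaw α)).map fun z => next q z.2 z.1

instance {n : ℕ} (α : Fin n × Fin n → ProbabilityMeasure ℕ)
    (τ : Arr n → ProbabilityMeasure (Arr n)) : IsMarkovKernel (transition α τ) :=
  ⟨fun _ => Measure.isProbabilityMeasure_map (Measurable.of_discrete).aemeasurable⟩

/-- The law of the queue lengths at time `t`, when `μ` is their law at time `0`. -/
def queueLaw {n : ℕ} (α : Fin n × Fin n → ProbabilityMeasure ℕ)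
    (τ : Arr n → ProbabilityMeasure (Arr n)) (μ : ProbabilityMeasure (Arr n)) :
    ℕ → ProbabilityMeasure (Arr n)
  | 0 => μ
  | t + 1 => ⟨(queueLaw α τ μ t : Measure (Arr n)).bind (transition α τ), inferInstance⟩

/-- The constant `M_r`, for `ν` and for arrivals with rates `lam`, standard deviations `σ` and
bound `aMax`. -/
def momentBound {n : ℕ} (ν lam σ : Vec n) (aMax : ℝ) (r : ℕ) : ℝ :=
  (2 : ℝ) ^ (1 / (r : ℝ)) *
    max (8 * (‖lam‖ ^ 2 + ‖σ‖ ^ 2 + n) / minEntry ν)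
      ((√r * Real.exp 1) ^ (1 / (r : ℝ)) * (16 * (r / Real.exp 1)) *
        (n * aMax / minEntry ν) * (n * aMax + 1))

end

end InputQueuedSwitch

/-! ### Ergodicity of countable Markov chains with a geometric drift -/

namespace ProbabilityTheory.Kernel

variable {X : Type*} [MeasurableSpace X]

/-! The proof rests on two drift estimates, together with the fact that one slot moves the queue
vector by at most D = n·aMax.

Stability: the maximal weight exceeds ⟨q, λ⟩ by at least ε ν_min ‖q‖, so ‖q‖ has negative drift when
it is large (`integral_norm_le`). Bounded increments turn this into a geometric drift of exp(θ‖q‖)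
(`exists_exp_drift`). The empty state is reached from every state at all large times, so a Harris
argument, contraction of a weighted oscillation, yields the stationary law and convergence to it
(`exists_contraction`, `exists_invariant_tendsto`).

Collapse: the drift of ‖q_⊥‖ stays negative at a rate independent of ε (`integral_norm_perp_le`).
Since q_⊥ lies in the polar cone of K, its row and column sums are nonpositive, so ν + ν_min
q_⊥/‖q_⊥‖ is still doubly substochastic. By Birkhoff's theorem the MaxWeight schedule has at least
the weight of this array, which beats that of ν by ν_min ‖q_⊥‖ because ⟨q, q_⊥⟩ = ‖q_⊥‖². The
deficit ε costs at most ε‖ν‖‖q_⊥‖, half of this gain. Moving along K costs nothing: on K no schedule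
outweighs ν.

Moments: stationarity, tested on max(c, ‖q_⊥‖), makes the tail decay geometrically (`tail_step`,
`tail_le`). Summing over levels bounds every moment (`integral_pow_le_of_geometric_tail`), and
Stirling's bound on r! gives the form of M_r. -/

lemma isMarkovKernel_pow (κ : Kernel X X) [IsMarkovKernel κ] (m : ℕ) :
    IsMarkovKernel (κ ^ m) := by
  induction m with
  | zero => rw [pow_zero]; exact inferInstanceAs (IsMarkovKernel Kernel.id)
  | succ m ih => rw [_root_.pow_succ]; exact inferInstanceAs (IsMarkovKernel ((κ ^ m) ∘ₖ κ))

lemma integral_bind {κ : Kernel X X} {μ : Measure X} {f : X → ℝ} (hf : Integrable f (μ.bind κ)) :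
    ∫ y, f y ∂(μ.bind κ) = ∫ x, ∫ y, f y ∂κ x ∂μ := by
  rw [Measure.comp_eq_comp_const_apply] at hf ⊢
  simpa using Kernel.integral_comp hf

lemma abs_integral_le_of_abs_le {μ : Measure X} [IsProbabilityMeasure μ] {f : X → ℝ} {C : ℝ}
    (hf : ∀ x, |f x| ≤ C) : |∫ x, f x ∂μ| ≤ C := by
  simpa using norm_integral_le_of_norm_le_const (μ := μ) (f := f) (C := C) (ae_of_all _ hf)

/-! ### Weighted oscillations and Harris' contraction -/

section Bounded

variable [DiscreteMeasurableSpace X]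

lemma integrable_of_abs_le {μ : Measure X} [IsFiniteMeasure μ] {f : X → ℝ} {C : ℝ}
    (hf : ∀ x, |f x| ≤ C) : Integrable f μ :=
  Integrable.of_bound Measurable.of_discrete.aestronglyMeasurable C (ae_of_all _ hf)

lemma integral_pow_add {κ : Kernel X X} [IsMarkovKernel κ] {f : X → ℝ} {C : ℝ}
    (hf : ∀ x, |f x| ≤ C) (m k : ℕ) (x : X) :
    ∫ y, f y ∂(κ ^ (m + k)) x = ∫ u, ∫ y, f y ∂(κ ^ m) u ∂(κ ^ k) x := by
  have := isMarkovKernel_pow κ (m + k)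
  rw [Kernel.pow_add] at this ⊢
  exact Kernel.integral_comp (integrable_of_abs_le hf)

/-- Functions with a weighted oscillation bound are integrable as soon as the weight is. -/
lemma integrable_of_osc {μ : Measure X} [IsFiniteMeasure μ] {f V : X → ℝ} {c β : ℝ}
    (hV : Integrable V μ) (hf : ∀ x y, |f x - f y| ≤ c * (2 + β * V x + β * V y)) :
    Integrable f μ := by
  rcases isEmpty_or_nonempty X with h | ⟨⟨x₀⟩⟩
  · exact Integrable.of_isEmpty
  refine Integrable.mono' (g := fun x => |f x₀| + c * (2 + β * V x + β * V x₀)) ?_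
    Measurable.of_discrete.aestronglyMeasurable (ae_of_all _ fun x => ?_)
  · exact (integrable_const _).add
      ((((integrable_const _).add (hV.const_mul β)).add (integrable_const _)).const_mul c)
  · have h1 := hf x x₀
    have h2 : |f x| ≤ |f x₀| + |f x - f x₀| := by
      have := abs_add_le (f x₀) (f x - f x₀); simpa using this
    rw [Real.norm_eq_abs]; linarith

/-- If two probability measures both charge the point `z`, then the integrals of a function
differ by less than its weighted oscillation suggests. -/
lemma abs_integral_sub_integral_le {μ μ' : Measure X} [IsProbabilityMeasure μ]
    [IsProbabilityMeasure μ'] {f V : X → ℝ} {c β : ℝ} (z : X)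
    (hc : 0 ≤ c) (hβ : 0 ≤ β) (hV0 : ∀ x, 0 ≤ V x) (hV : Integrable V μ) (hV' : Integrable V μ')
    (hf : ∀ x y, |f x - f y| ≤ c * (2 + β * V x + β * V y)) :
    |∫ x, f x ∂μ - ∫ x, f x ∂μ'| ≤
      c * (2 * (1 - μ.real {z} * μ'.real {z}) + β * ∫ x, V x ∂μ + β * ∫ x, V x ∂μ') := by
  classical
  obtain ⟨χ, hχ⟩ : ∃ χ : X → ℝ, χ = Set.indicator {z} fun _ => 1 := ⟨_, rfl⟩
  -- For x = y = z the left side vanishes, so the constant 2 can be dropped at this pair.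
  -- Integrating over independent x and y then saves the mass of (z, z).
  have hpt : ∀ x y, |f x - f y| ≤ c * (2 * (1 - χ x * χ y) + β * V x + β * V y) := by
    intro x y
    by_cases hx : x = z
    · by_cases hy : y = z
      · have := mul_nonneg hβ (hV0 z)
        simpa [hχ, hx, hy] using mul_nonneg hc (add_nonneg this this)
      · simpa [hχ, hy] using hf x y
    · simpa [hχ, hx] using hf x y
  have hχb : ∀ x, |χ x| ≤ 1 := fun x => by
    by_cases hx : x = z <;> simp [hχ, hx]
  have hint : ∀ m : Measure X, IsProbabilityMeasure m → ∫ x, χ x ∂m = m.real {z} := by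
    intro m _
    rw [hχ, integral_indicator (MeasurableSet.singleton z)]
    simp [measureReal_def]
  have hfi := integrable_of_osc hV hf
  have hfi' := integrable_of_osc hV' hf
  have hχi : Integrable χ μ := integrable_of_abs_le hχb
  have hχi' : Integrable χ μ' := integrable_of_abs_le hχb
  have h1 : ∀ y, |∫ x, f x ∂μ - f y| ≤
      c * (2 * (1 - μ.real {z} * χ y) + β * ∫ x, V x ∂μ + β * V y) := by
    intro y
    have e1 : ∫ x, f x ∂μ - f y = ∫ x, (f x - f y) ∂μ := by
      rw [integral_sub hfi (integrable_const _)]; simp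
    have i1 : Integrable (fun x => 2 * (1 - χ x * χ y)) μ :=
      ((integrable_const _).sub (hχi.mul_const _)).const_mul _
    have i2 : Integrable (fun x => 2 * (1 - χ x * χ y) + β * V x) μ := i1.add (hV.const_mul β)
    have i3 : Integrable (fun x => c * (2 * (1 - χ x * χ y) + β * V x + β * V y)) μ :=
      (i2.add (integrable_const _)).const_mul _
    rw [e1]
    refine (abs_integral_le_integral_abs).trans
      ((integral_mono (hfi.sub (integrable_const _)).abs i3 fun x => hpt x y).trans_eq ?_)
    rw [integral_const_mul, integral_add i2 (integrable_const _),
      integral_add i1 (hV.const_mul β), integral_const_mul, integral_const_mul,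
      integral_sub (integrable_const _) (hχi.mul_const _), integral_mul_const, hint μ inferInstance]
    simp
  have e2 : ∫ x, f x ∂μ - ∫ x, f x ∂μ' = ∫ y, (∫ x, f x ∂μ - f y) ∂μ' := by
    rw [integral_sub (integrable_const _) hfi']; simp
  have i1 : Integrable (fun y => 2 * (1 - μ.real {z} * χ y)) μ' :=
    ((integrable_const _).sub (hχi'.const_mul _)).const_mul _
  have i2 : Integrable (fun y => 2 * (1 - μ.real {z} * χ y) + β * ∫ x, V x ∂μ) μ' :=
    i1.add (integrable_const _)
  have i3 : Integrable
      (fun y => c * (2 * (1 - μ.real {z} * χ y) + β * ∫ x, V x ∂μ + β * V y)) μ' :=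
    (i2.add (hV'.const_mul _)).const_mul _
  rw [e2]
  refine (abs_integral_le_integral_abs).trans
    ((integral_mono ((integrable_const _).sub hfi').abs i3 h1).trans_eq ?_)
  rw [integral_const_mul, integral_add i2 (hV'.const_mul _), integral_add i1 (integrable_const _),
    integral_const_mul, integral_const_mul, integral_sub (integrable_const _) (hχi'.const_mul _),
    integral_const_mul, hint μ' inferInstance, integral_const_mul β]
  simp

/-- The arithmetic behind Harris' theorem: the choice of the weight and of the contraction rate. -/
lemma exists_weight_rate {γ K R a : ℝ} (hγ0 : 0 ≤ γ) (hγ : γ < 1) (hK : 0 ≤ K)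
    (hR : 2 * K < (1 - γ) * R) (ha : 0 < a) :
    ∃ β ρ : ℝ, 0 < β ∧ 0 ≤ ρ ∧ ρ < 1 ∧
      (∀ S, R ≤ S → 2 + β * (γ * S + 2 * K) ≤ ρ * (2 + β * S)) ∧
      ∀ S, 0 ≤ S → 2 * (1 - a ^ 2) + β * (γ * S + 2 * K) ≤ ρ * (2 + β * S) := by
  have hRpos : 0 < R := by
    by_contra h
    nlinarith [mul_nonneg (sub_nonneg.2 hγ.le) (sub_nonneg.2 (not_lt.1 h))]
  -- The weight is so small that the additive term 2Kβ uses up only half of the gain 2a² from the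
  -- common point; this gives the rate 1 - a²/2 for small S.
  obtain ⟨β, hβ⟩ : ∃ β, β = a ^ 2 / (2 * (K + 1)) := ⟨_, rfl⟩
  have hβ0 : 0 < β := by rw [hβ]; positivity
  have hβK : β * (2 * K) ≤ a ^ 2 := by
    rw [hβ, div_mul_eq_mul_div, div_le_iff₀ (by positivity)]
    nlinarith [sq_nonneg a]
  -- For large S the drift alone contracts: γ₀ absorbs K at S = R, where ρ₁ gives equality, and
  -- beyond R the slopes compare because γ ≤ ρ.
  obtain ⟨γ₀, hγ₀⟩ : ∃ γ₀, γ₀ = γ + 2 * K / R := ⟨_, rfl⟩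
  have hγ₀1 : γ₀ < 1 := by
    have : 2 * K / R < 1 - γ := by rwa [div_lt_iff₀ hRpos]
    linarith
  have hγ₀R : γ₀ * R = γ * R + 2 * K := by rw [hγ₀]; field_simp
  obtain ⟨ρ₁, hρ₁⟩ : ∃ ρ₁, ρ₁ = (2 + β * R * γ₀) / (2 + β * R) := ⟨_, rfl⟩
  have hβR : 0 < β * R := by positivity
  have hρ₁1 : ρ₁ < 1 := by
    rw [hρ₁, div_lt_one (by positivity)]; nlinarith
  have hρ₁e : ρ₁ * (2 + β * R) = 2 + β * R * γ₀ := by rw [hρ₁]; field_simp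
  refine ⟨β, max (max γ ρ₁) (1 - a ^ 2 / 2), hβ0, le_trans hγ0 (le_max_of_le_left (le_max_left _ _)),
    max_lt (max_lt hγ hρ₁1) (by nlinarith [pow_pos ha 2]), ?_, ?_⟩
  · intro S hS
    have h1 : γ ≤ max (max γ ρ₁) (1 - a ^ 2 / 2) := le_max_of_le_left (le_max_left _ _)
    have h2 : ρ₁ ≤ max (max γ ρ₁) (1 - a ^ 2 / 2) := le_max_of_le_left (le_max_right _ _)
    generalize max (max γ ρ₁) (1 - a ^ 2 / 2) = ρ at h1 h2
    have h3 : 2 + β * R * γ₀ ≤ ρ * (2 + β * R) := by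
      rw [← hρ₁e]; exact mul_le_mul_of_nonneg_right h2 (by positivity)
    have h4 : β * (S - R) * γ ≤ β * (S - R) * ρ :=
      mul_le_mul_of_nonneg_left h1 (mul_nonneg hβ0.le (sub_nonneg.2 hS))
    have h5 : β * R * γ₀ = β * (γ * R + 2 * K) := by rw [← hγ₀R]; ring
    nlinarith
  · intro S hS
    have h1 : γ ≤ max (max γ ρ₁) (1 - a ^ 2 / 2) := le_max_of_le_left (le_max_left _ _)
    have h2 : 1 - a ^ 2 / 2 ≤ max (max γ ρ₁) (1 - a ^ 2 / 2) := le_max_right _ _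
    generalize max (max γ ρ₁) (1 - a ^ 2 / 2) = ρ at h1 h2
    have h4 : β * S * γ ≤ β * S * ρ := mul_le_mul_of_nonneg_left h1 (by positivity)
    nlinarith

/-- Harris' theorem, contraction form: a geometric drift towards a set from which all transitions
charge a common point contracts a weighted oscillation. -/
lemma exists_contraction {κ : Kernel X X} [IsMarkovKernel κ] {V : X → ℝ} {γ K R a : ℝ} (z : X)
    (hγ0 : 0 ≤ γ) (hγ : γ < 1) (hK : 0 ≤ K) (hV0 : ∀ x, 0 ≤ V x)
    (hVi : ∀ x, Integrable V (κ x)) (hdrift : ∀ x, ∫ y, V y ∂κ x ≤ γ * V x + K)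
    (hR : 2 * K < (1 - γ) * R) (ha : 0 < a) (hmin : ∀ x, V x ≤ R → a ≤ (κ x).real {z}) :
    ∃ β ρ : ℝ, 0 < β ∧ 0 ≤ ρ ∧ ρ < 1 ∧ ∀ (f : X → ℝ) (c : ℝ), 0 ≤ c →
      (∀ x y, |f x - f y| ≤ c * (2 + β * V x + β * V y)) →
      ∀ x y, |∫ u, f u ∂κ x - ∫ u, f u ∂κ y| ≤ ρ * c * (2 + β * V x + β * V y) := by
  obtain ⟨β, ρ, hβ, hρ0, hρ1, hfar, hnear⟩ := exists_weight_rate hγ0 hγ hK hR ha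
  refine ⟨β, ρ, hβ, hρ0, hρ1, fun f c hc hf x y => ?_⟩
  have key := abs_integral_sub_integral_le z hc hβ.le hV0 (hVi x) (hVi y) hf
  refine key.trans ?_
  rw [mul_comm ρ c, mul_assoc]
  refine mul_le_mul_of_nonneg_left ?_ hc
  have hx := mul_le_mul_of_nonneg_left (hdrift x) hβ.le
  have hy := mul_le_mul_of_nonneg_left (hdrift y) hβ.le
  have hpx : 0 ≤ (κ x).real {z} := measureReal_nonneg
  have hpy : 0 ≤ (κ y).real {z} := measureReal_nonneg
  -- Either the pair is far out and the drift contracts, or both points lie in the sublevel set and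
  -- the common point z does.
  rcases le_or_gt R (V x + V y) with h | h
  · have := hfar _ h
    nlinarith [mul_nonneg hpx hpy]
  · have h1 := hmin x (by linarith [hV0 y])
    have h2 := hmin y (by linarith [hV0 x])
    have := hnear _ (add_nonneg (hV0 x) (hV0 y))
    have h3 : a ^ 2 ≤ (κ x).real {z} * (κ y).real {z} := by
      rw [sq]; exact mul_le_mul h1 h2 ha.le hpx
    nlinarith

/-- Each step multiplies the oscillation constant by ρ, and a function bounded by C starts with
constant C since 2C dominates its plain oscillation. -/
lemma abs_integral_pow_sub_le {κ : Kernel X X} [IsMarkovKernel κ] {V : X → ℝ} {β ρ : ℝ}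
    (hβ : 0 < β) (hρ0 : 0 ≤ ρ) (hV0 : ∀ x, 0 ≤ V x)
    (hcontr : ∀ (f : X → ℝ) (c : ℝ), 0 ≤ c →
      (∀ x y, |f x - f y| ≤ c * (2 + β * V x + β * V y)) →
      ∀ x y, |∫ u, f u ∂κ x - ∫ u, f u ∂κ y| ≤ ρ * c * (2 + β * V x + β * V y))
    {f : X → ℝ} {C : ℝ} (hC : 0 ≤ C) (hf : ∀ x, |f x| ≤ C) (k : ℕ) (x y : X) :
    |∫ u, f u ∂(κ ^ k) x - ∫ u, f u ∂(κ ^ k) y| ≤ ρ ^ k * C * (2 + β * V x + β * V y) := by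
  induction k generalizing x y with
  | zero =>
    have e : ∀ x, ∫ u, f u ∂(κ ^ 0) x = f x := fun x => by
      rw [pow_zero]
      change ∫ u, f u ∂(Kernel.id x) = f x
      rw [Kernel.id_apply, integral_dirac]
    rw [e, e, pow_zero, one_mul]
    have h1 := abs_sub (f x) (f y)
    have h2 : 0 ≤ C * (β * V x + β * V y) :=
      mul_nonneg hC (add_nonneg (mul_nonneg hβ.le (hV0 x)) (mul_nonneg hβ.le (hV0 y)))
    nlinarith [hf x, hf y]
  | succ k ih =>
    have := hcontr (fun u => ∫ w, f w ∂(κ ^ k) u) (ρ ^ k * C) (by positivity) ih x y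
    rw [integral_pow_add hf, integral_pow_add hf, pow_one]
    rw [pow_succ']; simpa [mul_assoc] using this

/-- A geometric drift bounds the mean of the Lyapunov function at all times. -/
lemma integral_pow_le {κ : Kernel X X} [IsMarkovKernel κ] {V : X → ℝ} {γ K : ℝ}
    (hγ0 : 0 ≤ γ) (hγ : γ < 1) (hV0 : ∀ x, 0 ≤ V x)
    (hVi : ∀ x, Integrable V (κ x)) (hdrift : ∀ x, ∫ y, V y ∂κ x ≤ γ * V x + K)
    (m : ℕ) (x : X) :
    Integrable V ((κ ^ m) x) ∧ ∫ y, V y ∂(κ ^ m) x ≤ γ ^ m * V x + K / (1 - γ) * (1 - γ ^ m) := by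
  induction m generalizing x with
  | zero =>
    have e : (κ ^ 0) x = Measure.dirac x := by
      rw [pow_zero]; exact Kernel.id_apply x
    rw [e, integral_dirac]
    refine ⟨?_, by simp⟩
    refine integrable_dirac (by finiteness)
  | succ m ih =>
    have hne : 1 - γ ≠ 0 := by linarith
    have := isMarkovKernel_pow κ m
    have hb : ∀ u, ‖∫ y, ‖V y‖ ∂κ u‖ ≤ γ * V u + K := fun u => by
      simp_rw [Real.norm_eq_abs, fun y => abs_of_nonneg (hV0 y)]
      rw [abs_of_nonneg (integral_nonneg hV0)]
      exact hdrift u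
    have hg : Integrable (fun u => γ * V u + K) ((κ ^ m) x) :=
      ((ih x).1.const_mul γ).add (integrable_const K)
    have hi : Integrable V ((κ ^ (m + 1)) x) := by
      rw [_root_.pow_succ']
      refine (ProbabilityTheory.integrable_comp_iff
        Measurable.of_discrete.aestronglyMeasurable).2 ⟨ae_of_all _ hVi, ?_⟩
      exact hg.mono' Measurable.of_discrete.aestronglyMeasurable (ae_of_all _ hb)
    refine ⟨hi, ?_⟩
    have e : ∫ y, V y ∂(κ ^ (m + 1)) x = ∫ u, ∫ y, V y ∂κ u ∂(κ ^ m) x := by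
      rw [_root_.pow_succ'] at hi ⊢
      exact Kernel.integral_comp hi
    have hi' : Integrable (fun u => ∫ y, V y ∂κ u) ((κ ^ m) x) := by
      rw [_root_.pow_succ'] at hi
      exact Integrable.integral_comp hi
    rw [e]
    calc ∫ u, ∫ y, V y ∂κ u ∂(κ ^ m) x ≤ ∫ u, (γ * V u + K) ∂(κ ^ m) x :=
          integral_mono hi' hg hdrift
      _ = γ * ∫ u, V u ∂(κ ^ m) x + K := by
          rw [integral_add ((ih x).1.const_mul γ) (integrable_const K), integral_const_mul]; simp
      _ ≤ γ * (γ ^ m * V x + K / (1 - γ) * (1 - γ ^ m)) + K :=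
          add_le_add_left (mul_le_mul_of_nonneg_left (ih x).2 hγ0) K
      _ = _ := by field_simp; ring

/-- The mean of a bounded function forgets the initial state. -/
lemma exists_forget {κ : Kernel X X} [IsMarkovKernel κ] {V : X → ℝ} {γ K : ℝ} (z : X)
    (hγ0 : 0 ≤ γ) (hγ : γ < 1) (hK : 0 ≤ K) (hV0 : ∀ x, 0 ≤ V x)
    (hfin : ∀ M, {x | V x ≤ M}.Finite)
    (hVi : ∀ x, Integrable V (κ x)) (hdrift : ∀ x, ∫ y, V y ∂κ x ≤ γ * V x + K)
    (hz : ∀ x, ∀ᶠ m in atTop, 0 < (κ ^ m) x {z}) :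
    ∃ (β : ℝ) (g : ℕ → ℝ), 0 < β ∧ (∀ t, 0 ≤ g t) ∧ Tendsto g atTop (𝓝 0) ∧
      ∀ (f : X → ℝ) (C : ℝ), 0 ≤ C → (∀ x, |f x| ≤ C) → ∀ t x y,
        |∫ u, f u ∂(κ ^ t) x - ∫ u, f u ∂(κ ^ t) y| ≤ g t * C * (2 + β * V x + β * V y) := by
  have h1γ : 0 < 1 - γ := by linarith
  obtain ⟨K', hK'⟩ : ∃ K', K' = K / (1 - γ) := ⟨_, rfl⟩
  have hK'0 : 0 ≤ K' := by rw [hK']; positivity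
  obtain ⟨R, hR⟩ : ∃ R, 2 * K' < (1 - γ) * R :=
    ⟨(2 * K' + 1) / (1 - γ), by rw [mul_div_cancel₀ _ h1γ.ne']; linarith⟩
  -- The sublevel set is finite, so a single time m serves all its states. Taking m ≥ 1 keeps the
  -- m-step drift factor below γ.
  have hev : ∀ᶠ m in atTop, ∀ x ∈ {x | V x ≤ R}, 0 < (κ ^ m) x {z} :=
    (Filter.eventually_all_finite (hfin R)).2 fun x _ => hz x
  obtain ⟨m, hm, hm1⟩ := (hev.and (eventually_ge_atTop 1)).exists
  have hMk := isMarkovKernel_pow κ m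
  obtain ⟨a, ha, hmin⟩ : ∃ a : ℝ, 0 < a ∧ ∀ x, V x ≤ R → a ≤ ((κ ^ m) x).real {z} := by
    rcases Set.eq_empty_or_nonempty {x | V x ≤ R} with he | hne
    · refine ⟨1, one_pos, fun x hx => ?_⟩
      have : x ∈ {x | V x ≤ R} := hx
      simp [he] at this
    · obtain ⟨x₀, hx₀, hmin⟩ :=
        Set.exists_min_image _ (fun x => ((κ ^ m) x).real {z}) (hfin R) hne
      exact ⟨_, ENNReal.toReal_pos (hm x₀ hx₀).ne' (measure_ne_top _ _), hmin⟩
  have hpow : γ ^ m ≤ γ := pow_le_of_le_one hγ0 hγ.le (by omega)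
  have hdm : ∀ x, ∫ y, V y ∂(κ ^ m) x ≤ γ * V x + K' := fun x => by
    refine (integral_pow_le hγ0 hγ hV0 hVi hdrift m x).2.trans ?_
    rw [← hK']
    nlinarith [mul_le_mul_of_nonneg_right hpow (hV0 x), mul_nonneg hK'0 (pow_nonneg hγ0 m)]
  obtain ⟨β, ρ, hβ, hρ0, hρ1, hcontr⟩ := exists_contraction (κ := κ ^ m) z hγ0 hγ hK'0 hV0
    (fun x => (integral_pow_le hγ0 hγ hV0 hVi hdrift m x).1) hdm hR ha hmin
  refine ⟨β, fun t => ρ ^ (t / m), hβ, fun t => by positivity, ?_, ?_⟩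
  · exact (tendsto_pow_atTop_nhds_zero_of_lt_one hρ0 hρ1).comp
      (Nat.tendsto_div_const_atTop (by omega))
  · intro f C hC hf t x y
    -- The remaining t % m steps are applied to f first, which preserves its bound; the contraction
    -- then acts t / m times.
    have e : ∀ x, ∫ u, f u ∂(κ ^ t) x =
        ∫ u, (∫ w, f w ∂(κ ^ (t % m)) u) ∂((κ ^ m) ^ (t / m)) x := fun x => by
      rw [← pow_mul, ← integral_pow_add hf, Nat.mod_add_div]
    rw [e, e]
    have := isMarkovKernel_pow κ (t % m)
    exact abs_integral_pow_sub_le hβ hρ0 hV0 hcontr hC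
      (fun u => abs_integral_le_of_abs_le hf) _ x y

end Bounded

/-- A Markov chain on a countable set with a geometric drift, from whose states a given state is
reached at all large times with positive probability, has a stationary distribution, to which it
converges from every initial distribution. -/
theorem exists_invariant_tendsto [TopologicalSpace X] [DiscreteTopology X]
    [DiscreteMeasurableSpace X] {κ : Kernel X X} [IsMarkovKernel κ] {V : X → ℝ} {γ K : ℝ} (z : X)
    (hγ0 : 0 ≤ γ) (hγ : γ < 1) (hK : 0 ≤ K) (hV0 : ∀ x, 0 ≤ V x)
    (hfin : ∀ M, {x | V x ≤ M}.Finite)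
    (hVi : ∀ x, Integrable V (κ x)) (hdrift : ∀ x, ∫ y, V y ∂κ x ≤ γ * V x + K)
    (hz : ∀ x, ∀ᶠ m in atTop, 0 < (κ ^ m) x {z}) :
    ∃ π : ProbabilityMeasure X, κ.Invariant (π : Measure X) ∧ Integrable V (π : Measure X) ∧
      ∀ (f : X → ℝ) (C : ℝ), (∀ x, |f x| ≤ C) → ∀ x,
        Tendsto (fun t => ∫ y, f y ∂(κ ^ t) x) atTop (𝓝 (∫ y, f y ∂(π : Measure X))) := by
  have hMk := isMarkovKernel_pow κ
  obtain ⟨β, g, hβ, hg0, hg, hforget⟩ := exists_forget z hγ0 hγ hK hV0 hfin hVi hdrift hz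
  have h1γ : 0 < 1 - γ := by linarith
  obtain ⟨B, hB⟩ : ∃ B, B = V z + K / (1 - γ) := ⟨_, rfl⟩
  have hB0 : 0 ≤ B := by rw [hB]; have := hV0 z; positivity
  have hVB : ∀ t, ∫ y, V y ∂(κ ^ t) z ≤ B := fun t => by
    refine (integral_pow_le hγ0 hγ hV0 hVi hdrift t z).2.trans ?_
    rw [hB]
    have h1 : γ ^ t ≤ 1 := pow_le_one₀ hγ0 hγ.le
    have h2 : 0 ≤ γ ^ t := pow_nonneg hγ0 t
    have h3 : 0 ≤ K / (1 - γ) := by positivity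
    nlinarith [mul_le_mul_of_nonneg_right h1 (hV0 z), mul_nonneg h3 h2]
  have hVit : ∀ t, Integrable V ((κ ^ t) z) := fun t =>
    (integral_pow_le hγ0 hγ hV0 hVi hdrift t z).1
  obtain ⟨μ, hμ⟩ : ∃ μ : ℕ → ProbabilityMeasure X, ∀ t, (μ t : Measure X) = (κ ^ t) z :=
    ⟨fun t => ⟨(κ ^ t) z, inferInstance⟩, fun _ => rfl⟩
  -- Markov's inequality with the uniform bound B on the mean of V; sublevel sets are finite, hence
  -- compact. Prokhorov's theorem then supplies a cluster point.
  have htight : IsTightMeasureSet {x | ∃ ν ∈ Set.range μ, (ν : Measure X) = x} := by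
    rw [isTightMeasureSet_iff_exists_isCompact_measure_compl_le]
    intro ε hε
    obtain ⟨δ, hδ0, hδ⟩ : ∃ δ : ℝ, 0 < δ ∧ ENNReal.ofReal δ ≤ ε := by
      rcases eq_or_ne ε ⊤ with h | h
      · exact ⟨1, one_pos, by simp [h]⟩
      · exact ⟨ε.toReal, ENNReal.toReal_pos hε.ne' h, ENNReal.ofReal_toReal_le⟩
    obtain ⟨M, hM⟩ : ∃ M, M = (B + 1) / δ := ⟨_, rfl⟩
    have hM0 : 0 < M := by rw [hM]; positivity
    refine ⟨{x | V x ≤ M}, (hfin M).isCompact, ?_⟩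
    rintro _ ⟨_, ⟨t, rfl⟩, rfl⟩
    rw [hμ]
    refine le_trans ?_ hδ
    have hmk := mul_meas_ge_le_integral_of_nonneg (ae_of_all _ hV0) (hVit t) M
    have hsub : {x | V x ≤ M}ᶜ ⊆ {x | M ≤ V x} := fun x hx => (not_le.1 (show ¬V x ≤ M from hx)).le
    refine (measure_mono hsub).trans ?_
    rw [← ENNReal.ofReal_toReal (measure_ne_top ((κ ^ t) z) {x | M ≤ V x})]
    apply ENNReal.ofReal_le_ofReal
    have h1 : M * ((κ ^ t) z).real {x | M ≤ V x} ≤ B := hmk.trans (hVB t)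
    have h2 : M * δ = B + 1 := by rw [hM]; field_simp
    change ((κ ^ t) z).real {x | M ≤ V x} ≤ δ
    by_contra hcon
    nlinarith [mul_lt_mul_of_pos_left (not_le.1 hcon) hM0]
  obtain ⟨π, -, hπ⟩ := (isCompact_closure_of_isTightMeasureSet htight).exists_mapClusterPt
    (f := atTop) (u := μ) (by
      rw [le_principal_iff, mem_map]
      exact Eventually.of_forall fun t => subset_closure (Set.mem_range_self t))
  have hlimz : ∀ (f : X → ℝ) (C : ℝ), (∀ x, |f x| ≤ C) →
      Tendsto (fun t => ∫ y, f y ∂(κ ^ t) z) atTop (𝓝 (∫ y, f y ∂(π : Measure X))) := by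
    intro f C hf
    have hC : 0 ≤ C := (abs_nonneg _).trans (hf z)
    have hcl : MapClusterPt (∫ y, f y ∂(π : Measure X)) atTop
        (fun t => ∫ y, f y ∂(κ ^ t) z) := by
      let F : BoundedContinuousFunction X ℝ :=
        BoundedContinuousFunction.ofNormedAddCommGroup f continuous_of_discreteTopology C hf
      have := hπ.tendsto_comp
        (ProbabilityMeasure.continuous_integral_boundedContinuousFunction F).continuousAt
      simpa [Function.comp_def, hμ, F] using this
    refine le_nhds_of_cauchy_adhp ?_ hcl
    change CauchySeq (fun t => ∫ y, f y ∂(κ ^ t) z)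
    -- The law at time t + k from z is a mixture of laws at time t, over starting points drawn from
    -- time k. Forgetting the start makes the sequence Cauchy, and the cluster point becomes its
    -- limit.
    refine cauchySeq_of_le_tendsto_0' (fun t => g t * C * (2 + β * V z + β * B)) ?_ ?_
    · intro t s hts
      obtain ⟨k, rfl⟩ := Nat.exists_eq_add_of_le hts
      rw [Real.dist_eq, abs_sub_comm, integral_pow_add hf]
      have hi : Integrable (fun u => ∫ y, f y ∂(κ ^ t) u) ((κ ^ k) z) :=
        integrable_of_abs_le fun u => abs_integral_le_of_abs_le hf
      have e : ∫ u, ∫ y, f y ∂(κ ^ t) u ∂(κ ^ k) z - ∫ y, f y ∂(κ ^ t) z =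
          ∫ u, (∫ y, f y ∂(κ ^ t) u - ∫ y, f y ∂(κ ^ t) z) ∂(κ ^ k) z := by
        rw [integral_sub hi (integrable_const _)]; simp
      have i1 : Integrable (fun u => (2 : ℝ) + β * V u) ((κ ^ k) z) :=
        (integrable_const _).add ((hVit k).const_mul _)
      have i2 : Integrable (fun u => g t * C * (2 + β * V u + β * V z)) ((κ ^ k) z) :=
        (i1.add (integrable_const _)).const_mul _
      rw [e]
      refine abs_integral_le_integral_abs.trans
        ((integral_mono (hi.sub (integrable_const _)).abs i2
          fun u => hforget f C hC hf t u z).trans ?_)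
      rw [integral_const_mul]
      refine mul_le_mul_of_nonneg_left ?_ (mul_nonneg (hg0 t) hC)
      rw [integral_add i1 (integrable_const _), integral_add (integrable_const _)
        ((hVit k).const_mul _), integral_const_mul]
      have := mul_le_mul_of_nonneg_left (hVB k) hβ.le
      simp only [MeasureTheory.integral_const, probReal_univ, one_smul]
      linarith
    · simpa using (hg.mul_const C).mul_const (2 + β * V z + β * B)
  refine ⟨π, ?_, ?_, ?_⟩
  · refine ext_of_forall_integral_eq_of_IsFiniteMeasure fun F => ?_
    have hF : ∀ x, |F x| ≤ ‖F‖ := fun x => F.norm_coe_le_norm x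
    have h1 := hlimz _ _ fun u => abs_integral_le_of_abs_le (μ := κ u) hF
    -- The means at times t + 1 have the same limit as those at times t, which is invariance when
    -- tested on F.
    have h2 := (hlimz _ _ hF).comp (tendsto_add_atTop_nat 1)
    rw [integral_bind (integrable_of_abs_le hF)]
    refine tendsto_nhds_unique h1 (h2.congr fun t => ?_)
    rw [Function.comp_apply, add_comm, integral_pow_add hF, pow_one]
  · refine ⟨Measurable.of_discrete.aestronglyMeasurable, ?_⟩
    rw [hasFiniteIntegral_iff_ofReal (ae_of_all _ hV0)]
    refine lt_of_le_of_lt ?_ (ENNReal.ofReal_lt_top (r := B))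
    -- V is unbounded, so the convergence applies only to its truncations; the bound B passes to V
    -- by monotone convergence.
    have e : ∀ x, ENNReal.ofReal (V x) = ⨆ k : ℕ, ENNReal.ofReal (min (V x) k) := fun x => by
      refine le_antisymm ?_ (iSup_le fun k => ENNReal.ofReal_le_ofReal (min_le_left _ _))
      obtain ⟨k, hk⟩ := exists_nat_ge (V x)
      exact le_iSup_of_le k (by rw [min_eq_left hk])
    simp_rw [e]
    rw [lintegral_iSup (f := fun (k : ℕ) x => ENNReal.ofReal (min (V x) k))
      (fun _ => Measurable.of_discrete) fun i j hij x =>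
      ENNReal.ofReal_le_ofReal (min_le_min_left _ (by exact_mod_cast hij))]
    refine iSup_le fun k => ?_
    have hmb : ∀ x, |min (V x) (k : ℝ)| ≤ k := fun x => by
      rw [abs_of_nonneg (le_min (hV0 x) k.cast_nonneg)]; exact min_le_right _ _
    rw [← ofReal_integral_eq_lintegral_ofReal (integrable_of_abs_le hmb)
      (ae_of_all _ fun x => le_min (hV0 x) k.cast_nonneg)]
    refine ENNReal.ofReal_le_ofReal (le_of_tendsto (hlimz _ _ hmb) (Eventually.of_forall fun t => ?_))
    exact (integral_mono (integrable_of_abs_le hmb) (hVit t) fun x => min_le_left _ _).trans (hVB t)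
  · intro f C hf x
    have hC : 0 ≤ C := (abs_nonneg _).trans (hf z)
    have h0 : Tendsto (fun t => ∫ y, f y ∂(κ ^ t) x - ∫ y, f y ∂(κ ^ t) z) atTop (𝓝 0) := by
      refine squeeze_zero_norm (fun t => hforget f C hC hf t x z) ?_
      simpa using (hg.mul_const C).mul_const (2 + β * V x + β * V z)
    simpa using h0.add (hlimz f C hf)

end ProbabilityTheory.Kernel

/-! ### Drift conditions for chains with bounded increments -/

namespace ProbabilityTheory.Kernel

variable {X : Type*} [MeasurableSpace X] [DiscreteMeasurableSpace X]

lemma integrable_of_increments {κ : Kernel X X} [IsMarkovKernel κ] {Z : X → ℝ} {D : ℝ} {x : X}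
    (hinc : ∀ᵐ y ∂κ x, |Z y - Z x| ≤ D) : Integrable Z (κ x) := by
  refine Integrable.of_bound Measurable.of_discrete.aestronglyMeasurable (|Z x| + D) ?_
  filter_upwards [hinc] with y hy
  have := abs_add_le (Z x) (Z y - Z x)
  rw [add_sub_cancel] at this
  rw [Real.norm_eq_abs]; linarith

/-- With bounded increments, a negative drift outside a sublevel set gives a geometric drift of
an exponential. -/
lemma exists_exp_drift {κ : Kernel X X} [IsMarkovKernel κ] {Z : X → ℝ} {D η k₀ : ℝ}
    (hD : 0 < D) (hη : 0 < η) (hinc : ∀ x, ∀ᵐ y ∂κ x, |Z y - Z x| ≤ D)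
    (hdrift : ∀ x, k₀ ≤ Z x → ∫ y, Z y ∂κ x ≤ Z x - η) :
    ∃ θ γ K : ℝ, 0 < θ ∧ 0 ≤ γ ∧ γ < 1 ∧ 0 ≤ K ∧ ∀ x,
      Integrable (fun y => Real.exp (θ * Z y)) (κ x) ∧
        ∫ y, Real.exp (θ * Z y) ∂κ x ≤ γ * Real.exp (θ * Z x) + K := by
  obtain ⟨θ, hθ⟩ : ∃ θ, θ = min (1 / D) (η / (2 * D ^ 2)) := ⟨_, rfl⟩
  have hθ0 : 0 < θ := by rw [hθ]; positivity
  have hθD : θ * D ≤ 1 := by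
    rw [← le_div_iff₀ hD, hθ]; exact min_le_left _ _
  have hθη : θ * (2 * D ^ 2) ≤ η := by
    rw [← le_div_iff₀ (by positivity), hθ]; exact min_le_right _ _
  refine ⟨θ, max 0 (1 - θ * η / 2), Real.exp (θ * (k₀ + D)), hθ0, le_max_left _ _,
    max_lt one_pos (by nlinarith [mul_pos hθ0 hη]), (Real.exp_pos _).le, fun x => ?_⟩
  have hub : ∀ᵐ y ∂κ x, Real.exp (θ * Z y) ≤ Real.exp (θ * (Z x + D)) := by
    filter_upwards [hinc x] with y hy
    exact Real.exp_le_exp.2 (mul_le_mul_of_nonneg_left (by linarith [le_of_abs_le hy]) hθ0.le)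
  have hi : Integrable (fun y => Real.exp (θ * Z y)) (κ x) := by
    refine Integrable.of_bound Measurable.of_discrete.aestronglyMeasurable
      (Real.exp (θ * (Z x + D))) ?_
    filter_upwards [hub] with y hy
    rwa [Real.norm_eq_abs, Real.abs_exp]
  refine ⟨hi, ?_⟩
  have hγ : (0 : ℝ) ≤ max 0 (1 - θ * η / 2) := le_max_left _ _
  rcases lt_or_ge (Z x) k₀ with h | h
  · have h1 : ∫ y, Real.exp (θ * Z y) ∂κ x ≤ ∫ _, Real.exp (θ * (k₀ + D)) ∂κ x := by
      refine integral_mono_ae hi (integrable_const _) ?_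
      filter_upwards [hub] with y hy
      refine hy.trans (Real.exp_le_exp.2 (mul_le_mul_of_nonneg_left (by linarith) hθ0.le))
    rw [MeasureTheory.integral_const, probReal_univ, one_smul] at h1
    nlinarith [mul_nonneg hγ (Real.exp_pos (θ * Z x)).le]
  · have hZi := integrable_of_increments (hinc x)
    obtain ⟨E, hE⟩ : ∃ E, E = Real.exp (θ * Z x) := ⟨_, rfl⟩
    have hE0 : 0 < E := by rw [hE]; exact Real.exp_pos _
    have h1 : ∫ y, Real.exp (θ * Z y) ∂κ x ≤
        ∫ y, E * (θ * (Z y - Z x) + (1 + θ ^ 2 * D ^ 2)) ∂κ x := by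
      refine integral_mono_ae hi
        ((((hZi.sub (integrable_const _)).const_mul θ).add (integrable_const _)).const_mul E) ?_
      filter_upwards [hinc x] with y hy
      have e : Real.exp (θ * Z y) = E * Real.exp (θ * (Z y - Z x)) := by
        rw [hE, ← Real.exp_add]; congr 1; ring
      have hb : |θ * (Z y - Z x)| ≤ θ * D := by
        rw [abs_mul, abs_of_pos hθ0]; exact mul_le_mul_of_nonneg_left hy hθ0.le
      have h2 := le_of_abs_le (Real.abs_exp_sub_one_sub_id_le (hb.trans hθD))
      have h3 : (θ * (Z y - Z x)) ^ 2 ≤ (θ * D) ^ 2 := sq_le_sq' (neg_le_of_abs_le hb)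
        (le_of_abs_le hb)
      change _ ≤ E * (θ * (Z y - Z x) + (1 + θ ^ 2 * D ^ 2))
      rw [e]
      refine mul_le_mul_of_nonneg_left ?_ hE0.le
      nlinarith
    have hi' : Integrable (fun y => θ * (Z y - Z x)) (κ x) :=
      (hZi.sub (integrable_const _)).const_mul θ
    rw [MeasureTheory.integral_const_mul, integral_add hi' (integrable_const _), MeasureTheory.integral_const_mul, integral_sub hZi (integrable_const _),
      MeasureTheory.integral_const, MeasureTheory.integral_const, probReal_univ, one_smul,
      one_smul] at h1
    have h4 := mul_le_mul_of_nonneg_left (hdrift x h) hθ0.le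
    have h5 : θ * (∫ y, Z y ∂κ x - Z x) + (1 + θ ^ 2 * D ^ 2) ≤ 1 - θ * η / 2 := by
      nlinarith [mul_le_mul_of_nonneg_left hθη hθ0.le]
    have h6 := (mul_le_mul_of_nonneg_left (h5.trans (le_max_right 0 _)) hE0.le)
    rw [← hE]
    nlinarith [Real.exp_pos (θ * (k₀ + D))]

/-- In equilibrium, the tail of a function with bounded increments and a negative drift loses a
fixed proportion over twice the size of the increments. -/
lemma tail_step {κ : Kernel X X} [IsMarkovKernel κ] {μ : Measure X} [IsProbabilityMeasure μ]
    (hinv : κ.Invariant μ) {Z : X → ℝ} {D η c : ℝ}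
    (hZ : Integrable Z μ) (hinc : ∀ x, ∀ᵐ y ∂κ x, |Z y - Z x| ≤ D)
    (hdrift : ∀ x, c + D < Z x → ∫ y, Z y ∂κ x ≤ Z x - η) :
    (D + η) * μ.real {x | c + D < Z x} ≤ D * μ.real {x | c - D < Z x} := by
  -- The stationary mean drift of the truncation W vanishes. Pointwise this drift is at most -η
  -- above c + D, at most D on the strip between, and at most 0 below c - D, where W remains at c.
  obtain ⟨W, hW⟩ : ∃ W : X → ℝ, ∀ x, W x = max c (Z x) := ⟨_, fun _ => rfl⟩
  have hWi : Integrable W μ := by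
    rw [funext hW]; exact (integrable_const c).sup hZ
  have hWinc : ∀ x, ∀ᵐ y ∂κ x, |W y - W x| ≤ D := fun x => by
    filter_upwards [hinc x] with y hy
    rw [hW, hW]
    refine (abs_max_sub_max_le_max c (Z y) c (Z x)).trans ?_
    rw [sub_self, abs_zero]
    exact max_le ((abs_nonneg _).trans hy) hy
  have hbind : Integrable W (μ.bind κ) := by rwa [hinv.def]
  have e : ∫ x, W x ∂μ = ∫ x, ∫ y, W y ∂κ x ∂μ := by
    conv_lhs => rw [← hinv.def]
    exact integral_bind hbind
  have hPi : Integrable (fun x => ∫ y, W y ∂κ x) μ := by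
    rw [Measure.comp_eq_comp_const_apply] at hbind
    simpa using Integrable.integral_comp hbind
  have hpt : ∀ x, ∫ y, W y ∂κ x - W x ≤ D * Set.indicator {x | c - D < Z x} (fun _ => (1 : ℝ)) x -
      (D + η) * Set.indicator {x | c + D < Z x} (fun _ => (1 : ℝ)) x := by
    intro x
    have hWx := integrable_of_increments (hWinc x)
    have hD : 0 ≤ D := by
      obtain ⟨y, hy⟩ := (hinc x).exists
      exact (abs_nonneg _).trans hy
    have hmono : ∀ b : ℝ, (∀ᵐ y ∂κ x, W y ≤ b) → ∫ y, W y ∂κ x ≤ b := fun b hb => by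
      simpa using integral_mono_ae hWx (integrable_const b) hb
    by_cases h1 : c + D < Z x
    · have h2 : c - D < Z x := by linarith
      have e2 : ∫ y, W y ∂κ x = ∫ y, Z y ∂κ x := by
        refine integral_congr_ae ?_
        filter_upwards [hinc x] with y hy
        rw [hW, max_eq_right]
        linarith [neg_le_of_abs_le hy]
      have h3 := hdrift x h1
      have h4 : Z x ≤ W x := by rw [hW]; exact le_max_right _ _
      rw [Set.indicator_of_mem (show x ∈ {x | c - D < Z x} from h2),
        Set.indicator_of_mem (show x ∈ {x | c + D < Z x} from h1), e2]
      linarith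
    · rw [Set.indicator_of_notMem (show x ∉ {x | c + D < Z x} from h1)]
      by_cases h2 : c - D < Z x
      · rw [Set.indicator_of_mem (show x ∈ {x | c - D < Z x} from h2)]
        have := hmono (W x + D) (by
          filter_upwards [hWinc x] with y hy
          linarith [le_of_abs_le hy])
        linarith
      · rw [Set.indicator_of_notMem (show x ∉ {x | c - D < Z x} from h2)]
        have := hmono c (by
          filter_upwards [hinc x] with y hy
          rw [hW]
          exact max_le le_rfl (by linarith [le_of_abs_le hy, not_lt.1 h2]))
        have h4 : c ≤ W x := by rw [hW]; exact le_max_left _ _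
        linarith
  have hind : ∀ s : Set X, Integrable (Set.indicator s fun _ => (1 : ℝ)) μ := fun s =>
    (integrable_const _).indicator (MeasurableSet.of_discrete)
  have hval : ∀ s : Set X, ∫ x, Set.indicator s (fun _ => (1 : ℝ)) x ∂μ = μ.real s := fun s => by
    rw [integral_indicator MeasurableSet.of_discrete]; simp [measureReal_def]
  have h := integral_mono (hPi.sub hWi) (((hind _).const_mul D).sub ((hind _).const_mul (D + η))) hpt
  simp only [Pi.sub_apply] at h
  rw [integral_sub hPi hWi, integral_sub ((hind _).const_mul D) ((hind _).const_mul (D + η)),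
    MeasureTheory.integral_const_mul, MeasureTheory.integral_const_mul, hval, hval] at h
  linarith

/-- Iterates `tail_step` at c = k₀ + (2m + 1)D. Starting at c = k₀ - D, where the right-hand tail is
at most 1, accounts for the exponent m + 1. -/
lemma tail_le {κ : Kernel X X} [IsMarkovKernel κ] {μ : Measure X} [IsProbabilityMeasure μ]
    (hinv : κ.Invariant μ) {Z : X → ℝ} {D η k₀ : ℝ} (hD : 0 < D) (hη : 0 < η)
    (hZ : Integrable Z μ) (hinc : ∀ x, ∀ᵐ y ∂κ x, |Z y - Z x| ≤ D)
    (hdrift : ∀ x, k₀ ≤ Z x → ∫ y, Z y ∂κ x ≤ Z x - η) (m : ℕ) :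
    μ.real {x | k₀ + 2 * D * m < Z x} ≤ (D / (D + η)) ^ (m + 1) := by
  have hDη : 0 < D + η := by linarith
  have step : ∀ c, k₀ ≤ c + D →
      μ.real {x | c + D < Z x} ≤ D / (D + η) * μ.real {x | c - D < Z x} := fun c hc => by
    have := tail_step hinv hZ hinc fun x (hx : c + D < Z x) => hdrift x (hc.trans hx.le)
    rw [div_mul_eq_mul_div, le_div_iff₀ hDη]; linarith
  induction m with
  | zero =>
    have := step (k₀ - D) (by linarith)
    have h1 : μ.real {x | k₀ - D - D < Z x} ≤ 1 := measureReal_le_one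
    have h2 : 0 ≤ D / (D + η) := by positivity
    simp only [sub_add_cancel] at this
    simp only [Nat.cast_zero, mul_zero, add_zero, zero_add, pow_one]
    nlinarith
  | succ m ih =>
    have h := step (k₀ + 2 * D * m + D) (by nlinarith [mul_nonneg hD.le m.cast_nonneg (α := ℝ)])
    have e1 : k₀ + 2 * D * m + D + D = k₀ + 2 * D * (m + 1 : ℕ) := by push_cast; ring
    rw [e1, add_sub_cancel_right] at h
    rw [_root_.pow_succ']
    exact h.trans (mul_le_mul_of_nonneg_left ih (by positivity))

end ProbabilityTheory.Kernel

/-! ### Moments from geometric tails -/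

/-- Powers of a number of exceeded levels, as a sum over these levels. -/
lemma Nat.succ_pow_le_factorial_mul_sum_choose (N s : ℕ) :
    N ^ (s + 1) ≤ (s + 1).factorial * ∑ i ∈ Finset.range N, (i + s).choose s := by
  cases N with
  | zero => simp
  | succ N =>
    -- The hockey-stick identity sums to one binomial coefficient, which is a rising factorial over
    -- (s + 1)!.
    rw [Nat.sum_range_add_choose]
    refine (Nat.pow_succ_le_ascFactorial (N + 1) (s + 1)).trans_eq ?_
    rw [Nat.ascFactorial_eq_factorial_mul_choose]
    congr 1

/-- A geometric tail bounds all moments. -/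
lemma MeasureTheory.integral_pow_le_of_geometric_tail {X : Type*} [MeasurableSpace X]
    [DiscreteMeasurableSpace X] {μ : Measure X} [IsProbabilityMeasure μ] {Z : X → ℝ} {D k₀ ρ : ℝ}
    (hZ0 : ∀ x, 0 ≤ Z x) (hD : 0 < D) (hk₀ : 0 ≤ k₀) (hρ0 : 0 ≤ ρ) (hρ1 : ρ < 1)
    (htail : ∀ m : ℕ, μ.real {x | k₀ + 2 * D * m < Z x} ≤ ρ ^ (m + 1)) {r : ℕ} (hr : 1 ≤ r) :
    Integrable (fun x => Z x ^ r) μ ∧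
      ∫ x, Z x ^ r ∂μ ≤
        2 ^ (r - 1) * (k₀ ^ r + (2 * D) ^ r * (r.factorial * (1 / (1 - ρ) ^ r))) := by
  obtain ⟨s, rfl⟩ := Nat.exists_eq_add_of_le' hr
  have h1ρ : 0 < 1 - ρ := by linarith
  obtain ⟨A, hA⟩ : ∃ A : ℕ → Set X, ∀ m, A m = {x | k₀ + 2 * D * m < Z x} := ⟨_, fun _ => rfl⟩
  obtain ⟨S, hS⟩ : ∃ S : X → ENNReal, ∀ x, S x =
      ∑' m : ℕ, Set.indicator (A m) (fun _ => ENNReal.ofReal ((m + s).choose s)) x :=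
    ⟨_, fun _ => rfl⟩
  have hpt : ∀ x, ENNReal.ofReal (Z x ^ (s + 1)) ≤ ENNReal.ofReal (2 ^ s * k₀ ^ (s + 1)) +
      ENNReal.ofReal (2 ^ s * ((2 * D) ^ (s + 1) * (s + 1).factorial)) * S x := by
    intro x
    -- N counts the levels k₀ + 2Dm strictly below Z x; it is 0 when Z x ≤ k₀.
    obtain ⟨N, hN⟩ : ∃ N, N = ⌈(Z x - k₀) / (2 * D)⌉₊ := ⟨_, rfl⟩
    have hZN : Z x ≤ k₀ + 2 * D * N := by
      have := Nat.le_ceil ((Z x - k₀) / (2 * D))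
      rw [← hN, div_le_iff₀ (by positivity)] at this
      linarith
    have hmem : ∀ m ∈ Finset.range N, x ∈ A m := fun m hm => by
      have := Finset.mem_range.1 hm
      rw [hN, Nat.lt_ceil, lt_div_iff₀ (by positivity)] at this
      rw [hA]
      change k₀ + 2 * D * m < Z x
      linarith
    have h1 : Z x ^ (s + 1) ≤ 2 ^ s * k₀ ^ (s + 1) + 2 ^ s * ((2 * D) ^ (s + 1) *
        (s + 1).factorial) * ∑ m ∈ Finset.range N, ((m + s).choose s : ℝ) := by
      have h2 := add_pow_le hk₀ (by positivity : 0 ≤ 2 * D * (N : ℝ)) (s + 1)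
      rw [Nat.add_sub_cancel, mul_pow (2 * D)] at h2
      have h3 : (N : ℝ) ^ (s + 1) ≤
          (s + 1).factorial * ∑ m ∈ Finset.range N, ((m + s).choose s : ℝ) := by
        exact_mod_cast Nat.succ_pow_le_factorial_mul_sum_choose N s
      have h4 := mul_le_mul_of_nonneg_left h3 (by positivity : 0 ≤ 2 ^ s * (2 * D) ^ (s + 1))
      have h5 := pow_le_pow_left₀ (hZ0 x) hZN (s + 1)
      linarith
    have h6 : ENNReal.ofReal (∑ m ∈ Finset.range N, ((m + s).choose s : ℝ)) ≤ S x := by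
      rw [ENNReal.ofReal_sum_of_nonneg fun _ _ => Nat.cast_nonneg _, hS]
      refine le_trans (Finset.sum_le_sum fun m hm => ?_) (ENNReal.sum_le_tsum (Finset.range N))
      rw [Set.indicator_of_mem (hmem m hm)]
    refine (ENNReal.ofReal_le_ofReal h1).trans ?_
    rw [ENNReal.ofReal_add (by positivity) (mul_nonneg (by positivity)
      (Finset.sum_nonneg fun _ _ => Nat.cast_nonneg _)),
      ENNReal.ofReal_mul (p := 2 ^ s * ((2 * D) ^ (s + 1) * (s + 1).factorial)) (by positivity)]
    gcongr
  -- The negative binomial series evaluates the sum over levels; one factor ρ of the tail bound is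
  -- given away to match it.
  have hsum := hasSum_choose_mul_geometric_of_norm_lt_one (𝕜 := ℝ) s
    (r := ρ) (by rwa [Real.norm_eq_abs, abs_of_nonneg hρ0])
  have hSint : ∫⁻ x, S x ∂μ ≤ ENNReal.ofReal (1 / (1 - ρ) ^ (s + 1)) := by
    simp_rw [hS]
    rw [lintegral_tsum fun _ => Measurable.of_discrete.aemeasurable, ← hsum.tsum_eq,
      ENNReal.ofReal_tsum_of_nonneg (fun m => by positivity) hsum.summable]
    refine ENNReal.tsum_le_tsum fun m => ?_
    rw [lintegral_indicator_const MeasurableSet.of_discrete, ENNReal.ofReal_mul (by positivity)]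
    gcongr
    rw [← ENNReal.ofReal_toReal (measure_ne_top μ (A m)), hA]
    exact ENNReal.ofReal_le_ofReal ((htail m).trans (pow_le_pow_of_le_one hρ0 hρ1.le (by omega)))
  obtain ⟨T, hT⟩ : ∃ T : ℝ, T = 2 ^ s * k₀ ^ (s + 1) +
      2 ^ s * ((2 * D) ^ (s + 1) * (s + 1).factorial) * (1 / (1 - ρ) ^ (s + 1)) := ⟨_, rfl⟩
  have hT0 : 0 ≤ T := by rw [hT]; positivity
  have hlint : ∫⁻ x, ENNReal.ofReal (Z x ^ (s + 1)) ∂μ ≤ ENNReal.ofReal T := by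
    refine (lintegral_mono hpt).trans ?_
    rw [lintegral_add_left measurable_const, lintegral_const, measure_univ, mul_one,
      lintegral_const_mul _ Measurable.of_discrete, hT, ENNReal.ofReal_add (by positivity)
      (by positivity), ENNReal.ofReal_mul (p := 2 ^ s * ((2 * D) ^ (s + 1) * (s + 1).factorial))
      (by positivity)]
    gcongr
  have hnn : ∀ x, 0 ≤ Z x ^ (s + 1) := fun x => pow_nonneg (hZ0 x) _
  refine ⟨⟨Measurable.of_discrete.aestronglyMeasurable, ?_⟩, ?_⟩
  · rw [hasFiniteIntegral_iff_ofReal (ae_of_all _ hnn)]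
    exact hlint.trans_lt ENNReal.ofReal_lt_top
  · rw [integral_eq_lintegral_of_nonneg_ae (ae_of_all _ hnn)
      Measurable.of_discrete.aestronglyMeasurable]
    refine (ENNReal.toReal_le_of_le_ofReal hT0 hlint).trans_eq ?_
    rw [hT, Nat.add_sub_cancel]; ring

/-- The upper bound in Stirling's formula. -/
lemma Nat.factorial_le_stirling {r : ℕ} (hr : 1 ≤ r) :
    (r.factorial : ℝ) ≤ √r * Real.exp 1 * (r / Real.exp 1) ^ r := by
  obtain ⟨s, rfl⟩ := Nat.exists_eq_add_of_le' hr
  -- The Stirling sequence decreases, so its first term bounds it and produces the constant e.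
  have h := Stirling.stirlingSeq'_antitone (Nat.zero_le s)
  simp only [Function.comp_apply, Nat.succ_eq_add_one, zero_add, Stirling.stirlingSeq_one] at h
  rw [Stirling.stirlingSeq, div_le_iff₀ (by positivity)] at h
  refine h.trans_eq ?_
  rw [Real.sqrt_mul (by norm_num)]
  field_simp

namespace InputQueuedSwitch

variable {n : ℕ}

/-! ### Coordinate formulas -/

@[simp] lemma toVec_apply (q : Arr n) (p : Fin n × Fin n) : toVec q p = q p := rfl

lemma inner_eq_sum (x y : Vec n) : inner ℝ x y = ∑ p, x p * y p := by
  rw [PiLp.inner_apply]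
  exact Finset.sum_congr rfl fun p _ => by simp [mul_comm]

lemma norm_sq_eq_sum (x : Vec n) : ‖x‖ ^ 2 = ∑ p, x p ^ 2 := by
  rw [← real_inner_self_eq_norm_sq, inner_eq_sum]
  exact Finset.sum_congr rfl fun p _ => (sq _).symm

/-! ### The cone and its projection -/

lemma mem_cone_iff {x : Vec n} : x ∈ cone n ↔ ∃ w w' : Fin n → ℝ, (∀ i, 0 ≤ w i) ∧
    (∀ j, 0 ≤ w' j) ∧ ∀ p, x p = w p.1 + w' p.2 := by
  constructor
  · rintro ⟨w, w', hw, hw', rfl⟩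
    exact ⟨w, w', hw, hw', comb_apply w w'⟩
  · rintro ⟨w, w', hw, hw', hx⟩
    refine ⟨w, w', hw, hw', ?_⟩
    ext p
    rw [hx, comb_apply]

lemma add_mem_cone {x y : Vec n} (hx : x ∈ cone n) (hy : y ∈ cone n) : x + y ∈ cone n := by
  obtain ⟨w, w', hw, hw', hx⟩ := mem_cone_iff.1 hx
  obtain ⟨v, v', hv, hv', hy⟩ := mem_cone_iff.1 hy
  refine mem_cone_iff.2 ⟨w + v, w' + v', fun i => add_nonneg (hw i) (hv i),
    fun i => add_nonneg (hw' i) (hv' i), fun p => ?_⟩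
  simp only [PiLp.add_apply, hx, hy, Pi.add_apply]; ring

lemma smul_mem_cone {x : Vec n} (hx : x ∈ cone n) {c : ℝ} (hc : 0 ≤ c) : c • x ∈ cone n := by
  obtain ⟨w, w', hw, hw', hx⟩ := mem_cone_iff.1 hx
  refine mem_cone_iff.2 ⟨c • w, c • w', fun i => mul_nonneg hc (hw i),
    fun i => mul_nonneg hc (hw' i), fun p => ?_⟩
  simp only [PiLp.smul_apply, hx, Pi.smul_apply, smul_eq_mul]; ring

lemma convex_cone : Convex ℝ (cone n) := fun _ hx _ hy _ _ ha hb _ =>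
  add_mem_cone (smul_mem_cone hx ha) (smul_mem_cone hy hb)

lemma zero_mem_cone : (0 : Vec n) ∈ cone n :=
  mem_cone_iff.2 ⟨0, 0, fun _ => le_rfl, fun _ => le_rfl, fun p => by simp⟩

lemma rowVec_mem_cone (i : Fin n) : rowVec i ∈ cone n :=
  mem_cone_iff.2 ⟨fun k => if k = i then 1 else 0, 0, fun k => by positivity, fun _ => le_rfl,
    fun p => by simp [rowVec]⟩

lemma colVec_mem_cone (j : Fin n) : colVec j ∈ cone n :=
  mem_cone_iff.2 ⟨0, fun k => if k = j then 1 else 0, fun _ => le_rfl, fun k => by positivity,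
    fun p => by simp [colVec]⟩

/-- The variational characterization of the closest point in a convex set. -/
lemma inner_perp_sub_par_le_zero (x : Vec n) {z : Vec n} (hz : z ∈ cone n) :
    inner ℝ (perp x) (z - par x) ≤ 0 := by
  refine (norm_eq_iInf_iff_real_inner_le_zero convex_cone (par_spec x).1).1 ?_ z hz
  have : Nonempty (cone n) := ⟨⟨par x, (par_spec x).1⟩⟩
  refine le_antisymm (le_ciInf fun w => (par_spec x).2 w w.2) ?_
  exact ciInf_le (f := fun w : cone n => ‖x - w‖) ⟨0, by rintro _ ⟨w, rfl⟩; exact norm_nonneg _⟩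
    ⟨par x, (par_spec x).1⟩

/-- The variational inequality at 0 and at twice the projection, both in the cone, gives the two
opposite signs. -/
lemma inner_perp_par (x : Vec n) : inner ℝ (perp x) (par x) = 0 := by
  have h0 := inner_perp_sub_par_le_zero x zero_mem_cone
  have h2 := inner_perp_sub_par_le_zero x (smul_mem_cone (par_spec x).1 zero_le_two)
  rw [two_smul, add_sub_cancel_right] at h2
  rw [zero_sub, inner_neg_right] at h0
  linarith

lemma inner_perp_le_zero (x : Vec n) {z : Vec n} (hz : z ∈ cone n) :
    inner ℝ (perp x) z ≤ 0 := by
  have h := inner_perp_sub_par_le_zero x hz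
  rwa [inner_sub_right, inner_perp_par, sub_zero] at h

lemma par_add_perp (x : Vec n) : par x + perp x = x := by
  rw [perp]; abel

lemma inner_self_perp (x : Vec n) : inner ℝ x (perp x) = ‖perp x‖ ^ 2 := by
  nth_rw 1 [← par_add_perp x]
  rw [inner_add_left, real_inner_comm, inner_perp_par, zero_add, real_inner_self_eq_norm_sq]

lemma norm_perp_le_norm_sub_par (x y : Vec n) : ‖perp y‖ ≤ ‖y - par x‖ :=
  (par_spec y).2 _ (par_spec x).1

lemma norm_perp_le (x : Vec n) : ‖perp x‖ ≤ ‖x‖ := by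
  simpa [perp] using (par_spec x).2 0 zero_mem_cone

/-- The distance to a fixed set is 1-Lipschitz; this bounds the increments of ‖q_⊥‖. -/
lemma abs_norm_perp_sub_le (x y : Vec n) : |‖perp y‖ - ‖perp x‖| ≤ ‖y - x‖ := by
  have key : ∀ x y : Vec n, ‖perp y‖ - ‖perp x‖ ≤ ‖y - x‖ := fun x y => by
    have h1 := norm_perp_le_norm_sub_par x y
    have h2 : y - par x = (y - x) + perp x := by rw [perp]; abel
    rw [h2] at h1
    linarith [norm_add_le (y - x) (perp x)]
  rw [abs_le]
  have := key y x
  rw [norm_sub_rev] at this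
  exact ⟨by linarith, key x y⟩

/-- The projection of x competes with that of y, so the change of the squared distance is estimated
without knowing how the projection moves. -/
lemma norm_perp_sq_sub_le (x y : Vec n) :
    ‖perp y‖ ^ 2 - ‖perp x‖ ^ 2 ≤ ‖y‖ ^ 2 - ‖x‖ ^ 2 - 2 * inner ℝ (par x) (y - x) := by
  have h1 : ‖perp y‖ ^ 2 ≤ ‖y - par x‖ ^ 2 :=
    pow_le_pow_left₀ (norm_nonneg _) (norm_perp_le_norm_sub_par x y) 2
  have h2 : ‖perp x‖ ^ 2 = ‖x - par x‖ ^ 2 := rfl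
  rw [norm_sub_sq_real] at h1 h2
  rw [inner_sub_right, real_inner_comm y, real_inner_comm x]
  linarith

lemma sum_row_perp_le_zero (x : Vec n) (i : Fin n) : ∑ j, perp x (i, j) ≤ 0 := by
  have h := inner_perp_le_zero x (rowVec_mem_cone i)
  rw [inner_eq_sum, Fintype.sum_prod_type] at h
  simpa [rowVec, Finset.sum_ite_irrel] using h

lemma sum_col_perp_le_zero (x : Vec n) (j : Fin n) : ∑ i, perp x (i, j) ≤ 0 := by
  have h := inner_perp_le_zero x (colVec_mem_cone j)
  rw [inner_eq_sum, Fintype.sum_prod_type] at h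
  simpa [colVec] using h

lemma par_nonneg (x : Vec n) (p : Fin n × Fin n) : 0 ≤ par x p := by
  obtain ⟨w, w', hw, hw', h⟩ := mem_cone_iff.1 (par_spec x).1
  rw [h]; exact add_nonneg (hw _) (hw' _)

/-- On the cone, the weight of a substochastic array is at most that of any array of the face. -/
lemma sum_mul_le_of_mem_cone {x : Vec n} (hx : x ∈ cone n) {ν : Vec n} (hν : ν ∈ face n)
    {s : Fin n × Fin n → ℝ} (hrow : ∀ i, ∑ j, s (i, j) ≤ 1) (hcol : ∀ j, ∑ i, s (i, j) ≤ 1) :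
    ∑ p, x p * s p ≤ ∑ p, x p * ν p := by
  obtain ⟨w, w', hw, hw', h⟩ := mem_cone_iff.1 hx
  have e : ∀ t : Fin n × Fin n → ℝ, ∑ p, x p * t p =
      ∑ i, w i * ∑ j, t (i, j) + ∑ j, w' j * ∑ i, t (i, j) := fun t => by
    simp only [h, add_mul, Finset.sum_add_distrib]
    rw [Fintype.sum_prod_type, Fintype.sum_prod_type_right]
    simp only [Finset.mul_sum]
  rw [e, e fun p => ν p]
  refine add_le_add (Finset.sum_le_sum fun i _ => mul_le_mul_of_nonneg_left ?_ (hw i))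
    (Finset.sum_le_sum fun j _ => mul_le_mul_of_nonneg_left ?_ (hw' j))
  · exact (hrow i).trans_eq (hν.2.1 i).symm
  · exact (hcol j).trans_eq (hν.2.2 j).symm

lemma minEntry_le (ν : Vec n) (p : Fin n × Fin n) : minEntry ν ≤ ν p :=
  ciInf_le (Set.finite_range _).bddBelow p

/-! ### Schedules of maximal weight -/

/-- A doubly stochastic array has at most the maximal weight of a schedule. -/
lemma IsMaxWeight.sum_mul_le_of_doublyStochastic {q s : Arr n} (hs : IsMaxWeight q s)
    {A : Matrix (Fin n) (Fin n) ℝ} (hA : A ∈ doublyStochastic ℝ (Fin n)) :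
    ∑ p, (q p : ℝ) * A p.1 p.2 ≤ ∑ p, (q p : ℝ) * s p := by
  -- Birkhoff's theorem: a convex combination of permutation matrices, each of which is a feasible
  -- schedule.
  obtain ⟨w, hw, hw1, rfl⟩ := exists_eq_sum_perm_of_mem_doublyStochastic hA
  have hperm : ∀ σ : Equiv.Perm (Fin n),
      ∑ p, (q p : ℝ) * σ.permMatrix ℝ p.1 p.2 ≤ ∑ p, (q p : ℝ) * s p := by
    intro σ
    obtain ⟨t, ht⟩ : ∃ t : Arr n, ∀ p, t p = if σ p.1 = p.2 then 1 else 0 := ⟨_, fun _ => rfl⟩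
    have hts : t ∈ schedules n := by
      refine ⟨fun p => ?_, fun i => ?_, fun j => ?_⟩
      · rw [ht]; split_ifs <;> simp
      · simp [ht]
      · have : ∀ i, (σ i = j) = (i = σ.symm j) := fun i => by
          rw [Equiv.eq_symm_apply]
        simp [ht, this]
    have := hs.2 t hts
    have h2 : ∑ p, (q p : ℝ) * t p ≤ ∑ p, (q p : ℝ) * s p := by exact_mod_cast this
    refine le_trans (le_of_eq (Finset.sum_congr rfl fun p _ => ?_)) h2
    rw [ht]
    simp [Equiv.Perm.permMatrix, PEquiv.toMatrix_apply, Equiv.toPEquiv_apply, eq_comm]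
  calc ∑ p, (q p : ℝ) * (∑ σ, w σ • σ.permMatrix ℝ) p.1 p.2
      = ∑ σ, w σ * ∑ p, (q p : ℝ) * σ.permMatrix ℝ p.1 p.2 := by
        simp only [Matrix.sum_apply, Matrix.smul_apply, smul_eq_mul, Finset.mul_sum]
        rw [Finset.sum_comm]
        exact Finset.sum_congr rfl fun σ _ => Finset.sum_congr rfl fun p _ => by ring
    _ ≤ ∑ σ, w σ * ∑ p, (q p : ℝ) * s p :=
        Finset.sum_le_sum fun σ _ => mul_le_mul_of_nonneg_left (hperm σ) (hw σ)
    _ = _ := by rw [← Finset.sum_mul, hw1, one_mul]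

/-- Every doubly substochastic array is dominated by a doubly stochastic one. -/
lemma exists_doublyStochastic_ge {r : Fin n × Fin n → ℝ} (h0 : ∀ p, 0 ≤ r p)
    (hrow : ∀ i, ∑ j, r (i, j) ≤ 1) (hcol : ∀ j, ∑ i, r (i, j) ≤ 1) :
    ∃ A ∈ doublyStochastic ℝ (Fin n), ∀ p, r p ≤ A p.1 p.2 := by
  obtain ⟨R, hR⟩ : ∃ R : Fin n → ℝ, ∀ i, R i = 1 - ∑ j, r (i, j) := ⟨_, fun _ => rfl⟩
  obtain ⟨C, hC⟩ : ∃ C : Fin n → ℝ, ∀ j, C j = 1 - ∑ i, r (i, j) := ⟨_, fun _ => rfl⟩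
  have hR0 : ∀ i, 0 ≤ R i := fun i => by rw [hR]; linarith [hrow i]
  have hC0 : ∀ j, 0 ≤ C j := fun j => by rw [hC]; linarith [hcol j]
  obtain ⟨T, hT⟩ : ∃ T, T = ∑ i, R i := ⟨_, rfl⟩
  have hTC : T = ∑ j, C j := by
    simp only [hT, hR, hC, Finset.sum_sub_distrib]
    rw [Finset.sum_comm]
  have hT0 : 0 ≤ T := by rw [hT]; exact Finset.sum_nonneg fun i _ => hR0 i
  -- If the total deficit T is 0, division returns 0, which is correct since every nonnegative
  -- deficit then vanishes.
  have hRT : ∀ i, R i * T / T = R i := fun i => by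
    rcases eq_or_ne T 0 with h | h
    · have := (Finset.sum_eq_zero_iff_of_nonneg fun i _ => hR0 i).1 (hT.symm.trans h) i
        (Finset.mem_univ i)
      simp [this]
    · field_simp
  have hCT : ∀ j, T * C j / T = C j := fun j => by
    rcases eq_or_ne T 0 with h | h
    · have := (Finset.sum_eq_zero_iff_of_nonneg fun i _ => hC0 i).1 (hTC.symm.trans h) j
        (Finset.mem_univ j)
      simp [this]
    · field_simp
  -- Row and column deficits have the same total T, so the rank-one array with entries R i · C j / T
  -- fills both at once.
  refine ⟨Matrix.of fun i j => r (i, j) + R i * C j / T, ?_, fun p => ?_⟩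
  · rw [mem_doublyStochastic_iff_sum]
    refine ⟨fun i j => ?_, fun i => ?_, fun j => ?_⟩
    · exact add_nonneg (h0 _) (div_nonneg (mul_nonneg (hR0 i) (hC0 j)) hT0)
    · simp only [Matrix.of_apply, Finset.sum_add_distrib]
      rw [← Finset.sum_div, ← Finset.mul_sum, ← hTC, hRT, hR]; ring
    · simp only [Matrix.of_apply, Finset.sum_add_distrib]
      rw [← Finset.sum_div, ← Finset.sum_mul, ← hT, hCT, hC]; ring
  · exact le_add_of_nonneg_right (div_nonneg (mul_nonneg (hR0 _) (hC0 _)) hT0)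

/-- A doubly substochastic array has at most the maximal weight of a schedule. -/
lemma IsMaxWeight.sum_mul_le {q s : Arr n} (hs : IsMaxWeight q s)
    {r : Fin n × Fin n → ℝ} (h0 : ∀ p, 0 ≤ r p)
    (hrow : ∀ i, ∑ j, r (i, j) ≤ 1) (hcol : ∀ j, ∑ i, r (i, j) ≤ 1) :
    ∑ p, (q p : ℝ) * r p ≤ ∑ p, (q p : ℝ) * s p := by
  obtain ⟨A, hA, hrA⟩ := exists_doublyStochastic_ge h0 hrow hcol
  refine le_trans (Finset.sum_le_sum fun p _ => ?_) (hs.sum_mul_le_of_doublyStochastic hA)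
  exact mul_le_mul_of_nonneg_left (hrA p) (Nat.cast_nonneg _)

/-- The drift bounds see the schedule only through this common weight, which is why the tie-breaking
rule plays no role. -/
lemma IsMaxWeight.sum_mul_eq {q s s' : Arr n} (hs : IsMaxWeight q s) (hs' : IsMaxWeight q s') :
    ∑ p, (q p : ℝ) * s p = ∑ p, (q p : ℝ) * s' p := by
  exact_mod_cast le_antisymm (hs'.2 s hs.1) (hs.2 s' hs'.1)

/-- A schedule of maximal weight serves a nonempty queue, if there is one. -/
lemma IsMaxWeight.exists_served {q s : Arr n} (hs : IsMaxWeight q s) (hq : q ≠ 0) :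
    ∃ p, 0 < q p ∧ 0 < s p := by
  classical
  obtain ⟨p₀, hp₀⟩ : ∃ p, q p ≠ 0 := by
    by_contra h; push Not at h; exact hq (funext h)
  have ht : (Pi.single p₀ 1 : Arr n) ∈ schedules n := by
    have h1 : ∀ p, (Pi.single p₀ 1 : Arr n) p ≤ 1 := fun p => by
      rw [Pi.single_apply]; split_ifs <;> simp
    refine ⟨h1, fun i => ?_, fun j => ?_⟩
    · calc ∑ j, (Pi.single p₀ 1 : Arr n) (i, j) ≤ ∑ j, if j = p₀.2 then 1 else 0 := by
            refine Finset.sum_le_sum fun j _ => ?_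
            rw [Pi.single_apply]
            split_ifs with h1 h2 <;> simp_all
            exact h2 (by rw [← h1])
        _ = 1 := by simp
    · calc ∑ i, (Pi.single p₀ 1 : Arr n) (i, j) ≤ ∑ i, if i = p₀.1 then 1 else 0 := by
            refine Finset.sum_le_sum fun i _ => ?_
            rw [Pi.single_apply]
            split_ifs with h1 h2 <;> simp_all
            exact h2 (by rw [← h1])
        _ = 1 := by simp
  have h := hs.2 _ ht
  by_contra hcon
  push Not at hcon
  have h0 : ∑ p, q p * s p = 0 := Finset.sum_eq_zero fun p _ => by
    rcases Nat.eq_zero_or_pos (q p) with h | h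
    · simp [h]
    · simp [Nat.le_zero.1 (hcon p h)]
  rw [h0] at h
  simp [Pi.single_apply] at h
  exact hp₀ h

/-! ### One time slot -/

lemma next_cast_eq (q a s : Arr n) (p : Fin n × Fin n) :
    (next q a s p : ℝ) = max ((q p : ℝ) + a p - s p) 0 := by
  rw [next]
  rcases le_total (s p) (q p + a p) with h | h
  · rw [Nat.cast_sub h, max_eq_left]
    · push_cast; ring
    · have : (s p : ℝ) ≤ q p + a p := by exact_mod_cast h
      linarith
  · rw [Nat.sub_eq_zero_of_le h, max_eq_right]
    · simp
    · have : (q p + a p : ℝ) ≤ s p := by exact_mod_cast h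
      linarith

lemma sum_schedule_le {s : Arr n} (hs : s ∈ schedules n) : ∑ p, (s p : ℝ) ≤ n := by
  have : ∑ p, s p ≤ n := by
    rw [Fintype.sum_prod_type]
    calc ∑ i, ∑ j, s (i, j) ≤ ∑ _i : Fin n, 1 := Finset.sum_le_sum fun i _ => hs.2.1 i
      _ = n := by simp
  exact_mod_cast this

lemma norm_toVec_next_sub_le {q a s : Arr n} {aMax : ℝ} (haMax : 1 ≤ aMax)
    (ha : ∀ p, (a p : ℝ) ≤ aMax) (hs : s ∈ schedules n) :
    ‖toVec (next q a s) - toVec q‖ ≤ n * aMax := by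
  have h0 : 0 ≤ n * aMax := by positivity
  rw [← abs_of_nonneg h0, ← abs_of_nonneg (norm_nonneg (toVec (next q a s) - toVec q)),
    ← sq_le_sq, norm_sq_eq_sum]
  calc ∑ p, (toVec (next q a s) - toVec q) p ^ 2 ≤ ∑ _p : Fin n × Fin n, aMax ^ 2 := by
        refine Finset.sum_le_sum fun p _ => ?_
        simp only [PiLp.sub_apply, toVec_apply, next_cast_eq]
        have h1 : (s p : ℝ) ≤ 1 := by exact_mod_cast hs.1 p
        have h2 := ha p
        have h3 : (0 : ℝ) ≤ q p := Nat.cast_nonneg _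
        have h4 : (0 : ℝ) ≤ a p := Nat.cast_nonneg _
        have h5 : (0 : ℝ) ≤ s p := Nat.cast_nonneg _
        apply sq_le_sq'
        · linarith [le_max_left ((q p : ℝ) + a p - s p) 0]
        · rw [sub_le_iff_le_add]
          exact max_le (by linarith) (by linarith)
    _ = (n * aMax) ^ 2 := by simp; ring

/-- Truncation at zero only decreases the square. In (a - s)² the cross term is dropped and s² ≤ s,
and a schedule serves at most n queues. -/
lemma norm_sq_next_sub_le {q a s : Arr n} (hs : s ∈ schedules n) :
    ‖toVec (next q a s)‖ ^ 2 - ‖toVec q‖ ^ 2 ≤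
      2 * ∑ p, (q p : ℝ) * a p - 2 * ∑ p, (q p : ℝ) * s p + ∑ p, (a p : ℝ) ^ 2 + n := by
  have key : ∀ p, (next q a s p : ℝ) ^ 2 - (q p : ℝ) ^ 2 ≤
      2 * ((q p : ℝ) * a p) - 2 * ((q p : ℝ) * s p) + (a p : ℝ) ^ 2 + s p := fun p => by
    have h1 : (s p : ℝ) ≤ 1 := by exact_mod_cast hs.1 p
    have h4 : (0 : ℝ) ≤ a p := Nat.cast_nonneg _
    have h5 : (0 : ℝ) ≤ s p := Nat.cast_nonneg _
    have h6 : (next q a s p : ℝ) ^ 2 ≤ ((q p : ℝ) + a p - s p) ^ 2 := by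
      rw [next_cast_eq]
      rcases max_cases ((q p : ℝ) + a p - s p) 0 with h | h
      · rw [h.1]
      · rw [h.1]; nlinarith [sq_nonneg ((q p : ℝ) + a p - s p)]
    nlinarith [mul_nonneg h4 h5, mul_nonneg h5 (sub_nonneg.2 h1)]
  rw [norm_sq_eq_sum, norm_sq_eq_sum, ← Finset.sum_sub_distrib]
  refine (Finset.sum_le_sum fun p _ => key p).trans ?_
  rw [Finset.sum_add_distrib, Finset.sum_add_distrib, Finset.sum_sub_distrib, ← Finset.mul_sum,
    ← Finset.mul_sum]
  linarith [sum_schedule_le hs]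

/-- Unused service only raises the queues, and the projection has nonnegative entries, so it may be
ignored. On the cone the schedule weighs at most as much as ν, which removes s from the projection
terms. -/
lemma norm_perp_sq_next_sub_le {q a s : Arr n} (hs : s ∈ schedules n) {ν : Vec n}
    (hν : ν ∈ face n) :
    ‖perp (toVec (next q a s))‖ ^ 2 - ‖perp (toVec q)‖ ^ 2 ≤
      2 * ∑ p, (q p : ℝ) * a p - 2 * ∑ p, (q p : ℝ) * s p + ∑ p, (a p : ℝ) ^ 2 + n -
        2 * ∑ p, par (toVec q) p * a p + 2 * ∑ p, par (toVec q) p * ν p := by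
  have h1 := norm_perp_sq_sub_le (toVec q) (toVec (next q a s))
  have h2 := norm_sq_next_sub_le (q := q) (a := a) hs
  have h3 : ∑ p, par (toVec q) p * a p - ∑ p, par (toVec q) p * s p ≤
      inner ℝ (par (toVec q)) (toVec (next q a s) - toVec q) := by
    rw [inner_eq_sum, ← Finset.sum_sub_distrib]
    refine Finset.sum_le_sum fun p _ => ?_
    rw [← mul_sub]
    refine mul_le_mul_of_nonneg_left ?_ (par_nonneg _ p)
    simp only [PiLp.sub_apply, toVec_apply, next_cast_eq]
    linarith [le_max_left ((q p : ℝ) + a p - s p) 0]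
  have h4 := sum_mul_le_of_mem_cone (par_spec (toVec q)).1 hν (s := fun p => (s p : ℝ))
    (fun i => by exact_mod_cast hs.2.1 i) (fun j => by exact_mod_cast hs.2.2 j)
  linarith

end InputQueuedSwitch

namespace InputQueuedSwitch

variable {n : ℕ}

/-! ### Arrivals -/

section Arrivals

variable {α : Fin n × Fin n → ProbabilityMeasure ℕ} {aMax : ℝ}

lemma IsArrivalLaw.integrable_sq (hα : IsArrivalLaw α aMax) (p : Fin n × Fin n) :
    Integrable (fun k : ℕ => (k : ℝ) ^ 2) (α p : Measure ℕ) := by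
  refine Integrable.of_bound Measurable.of_discrete.aestronglyMeasurable (aMax ^ 2) ?_
  filter_upwards [hα.1 p] with k hk
  rw [Real.norm_of_nonneg (by positivity)]
  exact pow_le_pow_left₀ (Nat.cast_nonneg _) hk 2

lemma IsArrivalLaw.integrable (hα : IsArrivalLaw α aMax) (p : Fin n × Fin n) :
    Integrable (fun k : ℕ => (k : ℝ)) (α p : Measure ℕ) := by
  refine Integrable.of_bound Measurable.of_discrete.aestronglyMeasurable aMax ?_
  filter_upwards [hα.1 p] with k hk
  rwa [Real.norm_of_nonneg (Nat.cast_nonneg _)]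

lemma IsArrivalLaw.integral_sq (hα : IsArrivalLaw α aMax) (p : Fin n × Fin n) :
    ∫ k : ℕ, (k : ℝ) ^ 2 ∂(α p : Measure ℕ) = arrivalMean α p ^ 2 + arrivalStd α p ^ 2 := by
  have hL : MemLp (fun k : ℕ => (k : ℝ)) 2 (α p : Measure ℕ) :=
    (memLp_two_iff_integrable_sq Measurable.of_discrete.aestronglyMeasurable).2 (hα.integrable_sq p)
  have h1 : arrivalStd α p ^ 2 = variance (fun k : ℕ => (k : ℝ)) (α p : Measure ℕ) :=
    Real.sq_sqrt (variance_nonneg _ _)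
  have h2 := variance_eq_sub hL
  have h3 : arrivalMean α p = ∫ k : ℕ, (k : ℝ) ∂(α p : Measure ℕ) := rfl
  rw [h1, h2, h3]
  simp only [Pi.pow_apply]
  ring

lemma IsArrivalLaw.sum_integral_sq (hα : IsArrivalLaw α aMax) :
    ∑ p, ∫ k : ℕ, (k : ℝ) ^ 2 ∂(α p : Measure ℕ) = ‖arrivalMean α‖ ^ 2 + ‖arrivalStd α‖ ^ 2 := by
  rw [norm_sq_eq_sum, norm_sq_eq_sum, ← Finset.sum_add_distrib]
  exact Finset.sum_congr rfl fun p _ => hα.integral_sq p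

/-- The left side is the total second moment of the arrivals; the bound makes the final constant
uniform in ε. -/
lemma IsArrivalLaw.norm_sq_add_norm_sq_le (hα : IsArrivalLaw α aMax) :
    ‖arrivalMean α‖ ^ 2 + ‖arrivalStd α‖ ^ 2 ≤ (n * aMax) ^ 2 := by
  rw [← hα.sum_integral_sq]
  calc ∑ p, ∫ k : ℕ, (k : ℝ) ^ 2 ∂(α p : Measure ℕ) ≤ ∑ _p : Fin n × Fin n, aMax ^ 2 := by
        refine Finset.sum_le_sum fun p _ => ?_
        have : ∫ k : ℕ, (k : ℝ) ^ 2 ∂(α p : Measure ℕ) ≤ ∫ _, aMax ^ 2 ∂(α p : Measure ℕ) := by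
          refine integral_mono_ae (hα.integrable_sq p) (integrable_const _) ?_
          filter_upwards [hα.1 p] with k hk
          exact pow_le_pow_left₀ (Nat.cast_nonneg _) hk 2
        simpa using this
    _ = (n * aMax) ^ 2 := by simp; ring

lemma integral_arrivalLaw_eval {g : ℕ → ℝ} (p : Fin n × Fin n) :
    ∫ a, g (a p) ∂(arrivalLaw α) = ∫ k, g k ∂(α p : Measure ℕ) := by
  have h := measurePreserving_eval (fun p => (α p : Measure ℕ)) p
  rw [← h.map_eq, integral_map h.measurable.aemeasurable
    Measurable.of_discrete.aestronglyMeasurable]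
  rfl

lemma integrable_arrivalLaw_eval {g : ℕ → ℝ} {p : Fin n × Fin n}
    (hg : Integrable g (α p : Measure ℕ)) : Integrable (fun a => g (a p)) (arrivalLaw α) :=
  (measurePreserving_eval (fun p => (α p : Measure ℕ)) p).integrable_comp_of_integrable hg

/-- The mean of a quadratic function of the arrivals. -/
lemma IsArrivalLaw.integral_quadratic (hα : IsArrivalLaw α aMax) (c₀ : ℝ)
    (c : Fin n × Fin n → ℝ) :
    Integrable (fun a : Arr n => c₀ + ∑ p, c p * a p + ∑ p, (a p : ℝ) ^ 2) (arrivalLaw α) ∧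
    ∫ a : Arr n, (c₀ + ∑ p, c p * a p + ∑ p, (a p : ℝ) ^ 2) ∂(arrivalLaw α) =
      c₀ + ∑ p, c p * arrivalMean α p + (‖arrivalMean α‖ ^ 2 + ‖arrivalStd α‖ ^ 2) := by
  have i1 : ∀ p, Integrable (fun a : Arr n => c p * (a p : ℝ)) (arrivalLaw α) := fun p =>
    (integrable_arrivalLaw_eval (hα.integrable p)).const_mul _
  have i2 : ∀ p, Integrable (fun a : Arr n => (a p : ℝ) ^ 2) (arrivalLaw α) := fun p =>
    integrable_arrivalLaw_eval (g := fun k => (k : ℝ) ^ 2) (hα.integrable_sq p)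
  have j1 : Integrable (fun a : Arr n => c₀ + ∑ p, c p * (a p : ℝ)) (arrivalLaw α) :=
    (integrable_const _).add (integrable_finsetSum _ fun p _ => i1 p)
  have j2 : Integrable (fun a : Arr n => ∑ p, (a p : ℝ) ^ 2) (arrivalLaw α) :=
    integrable_finsetSum _ fun p _ => i2 p
  refine ⟨j1.add j2, ?_⟩
  rw [integral_add j1 j2, integral_add (integrable_const _)
    (integrable_finsetSum _ fun p _ => i1 p), integral_finsetSum _ fun p _ => i1 p,
    integral_finsetSum _ fun p _ => i2 p, ← hα.sum_integral_sq, integral_const, probReal_univ,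
    one_smul]
  congr 1
  · congr 1
    refine Finset.sum_congr rfl fun p _ => ?_
    rw [integral_const_mul, integral_arrivalLaw_eval (g := fun k => (k : ℝ))]
    rfl
  · exact Finset.sum_congr rfl fun p _ =>
      integral_arrivalLaw_eval (g := fun k => (k : ℝ) ^ 2) p

end Arrivals

/-! ### Transitions -/

section Transitions

variable {α : Fin n × Fin n → ProbabilityMeasure ℕ} {aMax : ℝ}
  {τ : Arr n → ProbabilityMeasure (Arr n)}

lemma transition_apply (q : Arr n) : transition α τ q =
    ((τ q : Measure (Arr n)).prod (arrivalLaw α)).map fun z => next q z.2 z.1 := rfl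

lemma IsMaxWeightRule.ae_slot (hτ : IsMaxWeightRule τ) (hα : IsArrivalLaw α aMax) (q : Arr n) :
    ∀ᵐ z ∂(τ q : Measure (Arr n)).prod (arrivalLaw α),
      IsMaxWeight q z.1 ∧ ∀ p, (z.2 p : ℝ) ≤ aMax := by
  have h1 := Measure.quasiMeasurePreserving_fst (ν := arrivalLaw α).ae (hτ q)
  have h2 : ∀ᵐ a ∂(arrivalLaw α), ∀ p, (a p : ℝ) ≤ aMax := ae_all_iff.2 fun p =>
    (measurePreserving_eval (fun p => (α p : Measure ℕ)) p).quasiMeasurePreserving.ae (hα.1 p)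
  have h3 := Measure.quasiMeasurePreserving_snd (μ := (τ q : Measure (Arr n))).ae h2
  filter_upwards [h1, h3] with z hz1 hz3 using ⟨hz1, hz3⟩

lemma IsMaxWeightRule.exists_isMaxWeight (hτ : IsMaxWeightRule τ) (q : Arr n) :
    ∃ s, IsMaxWeight q s := (hτ q).exists

lemma ae_norm_sub_le (hτ : IsMaxWeightRule τ) (hα : IsArrivalLaw α aMax) (haMax : 1 ≤ aMax)
    (q : Arr n) : ∀ᵐ y ∂transition α τ q, ‖toVec y - toVec q‖ ≤ n * aMax := by
  rw [transition_apply, ae_map_iff Measurable.of_discrete.aemeasurable MeasurableSet.of_discrete]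
  filter_upwards [hτ.ae_slot hα q] with z hz
  exact norm_toVec_next_sub_le haMax hz.2 hz.1.1

lemma ae_abs_norm_sub_le (hτ : IsMaxWeightRule τ) (hα : IsArrivalLaw α aMax) (haMax : 1 ≤ aMax)
    (q : Arr n) : ∀ᵐ y ∂transition α τ q, |‖toVec y‖ - ‖toVec q‖| ≤ n * aMax := by
  filter_upwards [ae_norm_sub_le hτ hα haMax q] with y hy
  exact (abs_norm_sub_norm_le _ _).trans hy

lemma ae_abs_norm_perp_sub_le (hτ : IsMaxWeightRule τ) (hα : IsArrivalLaw α aMax)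
    (haMax : 1 ≤ aMax) (q : Arr n) :
    ∀ᵐ y ∂transition α τ q, |‖perp (toVec y)‖ - ‖perp (toVec q)‖| ≤ n * aMax := by
  filter_upwards [ae_norm_sub_le hτ hα haMax q] with y hy
  exact (abs_norm_perp_sub_le _ _).trans hy

/-- A bound on the increment of the square of a function bounds its drift. -/
lemma integral_transition_le (hτ : IsMaxWeightRule τ) (hα : IsArrivalLaw α aMax)
    {q : Arr n} {f : Arr n → ℝ} {Z c₀ : ℝ} {c : Fin n × Fin n → ℝ} (hZ : 0 < Z)
    (hf : Integrable f (transition α τ q))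
    (h : ∀ s a, IsMaxWeight q s →
      f (next q a s) ^ 2 - Z ^ 2 ≤ c₀ + ∑ p, c p * a p + ∑ p, (a p : ℝ) ^ 2) :
    ∫ y, f y ∂transition α τ q ≤ Z + (c₀ + ∑ p, c p * arrivalMean α p +
      (‖arrivalMean α‖ ^ 2 + ‖arrivalStd α‖ ^ 2)) / (2 * Z) := by
  obtain ⟨hi, he⟩ := hα.integral_quadratic c₀ c
  obtain ⟨g, hg⟩ : ∃ g : Arr n → ℝ, ∀ a, g a = c₀ + ∑ p, c p * a p + ∑ p, (a p : ℝ) ^ 2 :=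
    ⟨_, fun _ => rfl⟩
  simp_rw [← hg] at hi he h
  have hsnd := measurePreserving_snd (μ := (τ q : Measure (Arr n))) (ν := arrivalLaw α)
  have hi2 : Integrable (fun z : Arr n × Arr n => g z.2)
      ((τ q : Measure (Arr n)).prod (arrivalLaw α)) := hsnd.integrable_comp_of_integrable hi
  have he2 : ∫ z : Arr n × Arr n, g z.2 ∂(τ q : Measure (Arr n)).prod (arrivalLaw α) =
      ∫ a, g a ∂(arrivalLaw α) := by
    rw [← hsnd.map_eq, integral_map hsnd.measurable.aemeasurable
      Measurable.of_discrete.aestronglyMeasurable, hsnd.map_eq]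
  rw [transition_apply] at hf ⊢
  rw [integrable_map_measure Measurable.of_discrete.aestronglyMeasurable
    Measurable.of_discrete.aemeasurable] at hf
  rw [integral_map Measurable.of_discrete.aemeasurable
    Measurable.of_discrete.aestronglyMeasurable]
  calc ∫ z : Arr n × Arr n, f (next q z.2 z.1) ∂(τ q : Measure (Arr n)).prod (arrivalLaw α)
      ≤ ∫ z : Arr n × Arr n, (Z + g z.2 / (2 * Z))
          ∂(τ q : Measure (Arr n)).prod (arrivalLaw α) := by
        refine integral_mono_ae hf ((integrable_const Z).add (hi2.div_const _)) ?_
        filter_upwards [hτ.ae_slot hα q] with z hz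
        have h1 := h z.1 z.2 hz.1
        -- The tangent bound 2Z(f - Z) ≤ f² - Z² passes from the square to the function itself.
        have h2 : f (next q z.2 z.1) - Z ≤ g z.2 / (2 * Z) := by
          rw [le_div_iff₀ (by positivity)]
          nlinarith [sq_nonneg (f (next q z.2 z.1) - Z)]
        linarith
    _ = _ := by
        rw [integral_add (integrable_const Z) (hi2.div_const _), integral_div, he2, he]
        simp

/-- The drift of the norm of the queue lengths. -/
lemma integral_norm_le (hτ : IsMaxWeightRule τ) (hα : IsArrivalLaw α aMax) (haMax : 1 ≤ aMax)
    {ν : Vec n} (hν : ν ∈ face n) (hνpos : 0 < minEntry ν) {ε : ℝ} (hε : 0 < ε)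
    (hmean : arrivalMean α = (1 - ε) • ν) {q : Arr n} (hq : 0 < ‖toVec q‖) :
    ∫ y, ‖toVec y‖ ∂transition α τ q ≤ ‖toVec q‖ +
      (‖arrivalMean α‖ ^ 2 + ‖arrivalStd α‖ ^ 2 + n - 2 * ε * minEntry ν * ‖toVec q‖) /
        (2 * ‖toVec q‖) := by
  obtain ⟨s₀, hs₀⟩ := hτ.exists_isMaxWeight q
  have h := integral_transition_le hτ hα (f := fun y => ‖toVec y‖)
    (c₀ := n - 2 * ∑ p, (q p : ℝ) * s₀ p) (c := fun p => 2 * q p) hq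
    (Kernel.integrable_of_increments (ae_abs_norm_sub_le hτ hα haMax q)) (by
      intro s a hs
      have h1 := norm_sq_next_sub_le (q := q) (a := a) hs.1
      rw [hs.sum_mul_eq hs₀] at h1
      have h2 : ∑ p, 2 * (q p : ℝ) * a p = 2 * ∑ p, (q p : ℝ) * a p := by
        rw [Finset.mul_sum]; exact Finset.sum_congr rfl fun p _ => by ring
      rw [h2]; linarith)
  refine h.trans (add_le_add_right (div_le_div_of_nonneg_right ?_ (by positivity)) _)
  have h1 : ∑ p, 2 * (q p : ℝ) * arrivalMean α p = 2 * (1 - ε) * ∑ p, (q p : ℝ) * ν p := by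
    rw [Finset.mul_sum]
    refine Finset.sum_congr rfl fun p _ => ?_
    rw [hmean, PiLp.smul_apply, smul_eq_mul]; ring
  have h2 := hs₀.sum_mul_le (r := fun p => ν p) hν.1 (fun i => (hν.2.1 i).le)
    fun j => (hν.2.2 j).le
  have h3 : minEntry ν * ‖toVec q‖ ≤ ∑ p, (q p : ℝ) * ν p := by
    have h4 : ‖toVec q‖ ≤ ∑ p, (q p : ℝ) := by
      rw [← sq_le_sq₀ (norm_nonneg _) (Finset.sum_nonneg fun _ _ => Nat.cast_nonneg _),
        norm_sq_eq_sum]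
      exact Finset.sum_sq_le_sq_sum_of_nonneg fun _ _ => Nat.cast_nonneg _
    refine (mul_le_mul_of_nonneg_left h4 hνpos.le).trans ?_
    rw [Finset.mul_sum]
    refine Finset.sum_le_sum fun p _ => ?_
    rw [mul_comm]
    exact mul_le_mul_of_nonneg_left (minEntry_le ν p) (Nat.cast_nonneg _)
  rw [h1]
  nlinarith [mul_le_mul_of_nonneg_left h3 hε.le]

/-- The drift of the distance of the queue lengths to the cone. -/
lemma integral_norm_perp_le (hτ : IsMaxWeightRule τ) (hα : IsArrivalLaw α aMax)
    (haMax : 1 ≤ aMax) {ν : Vec n} (hν : ν ∈ face n) (hνpos : 0 < minEntry ν) {ε : ℝ}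
    (hε : 0 < ε) (hεν : ε * ‖ν‖ ≤ minEntry ν / 2)
    (hmean : arrivalMean α = (1 - ε) • ν) {q : Arr n} (hq : 0 < ‖perp (toVec q)‖) :
    ∫ y, ‖perp (toVec y)‖ ∂transition α τ q ≤ ‖perp (toVec q)‖ +
      (‖arrivalMean α‖ ^ 2 + ‖arrivalStd α‖ ^ 2 + n - minEntry ν * ‖perp (toVec q)‖) /
        (2 * ‖perp (toVec q)‖) := by
  obtain ⟨s₀, hs₀⟩ := hτ.exists_isMaxWeight q
  obtain ⟨x, hx⟩ : ∃ x, x = toVec q := ⟨_, rfl⟩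
  have hxq : ∀ p, x p = q p := fun p => by rw [hx]; rfl
  have h := integral_transition_le hτ hα (f := fun y => ‖perp (toVec y)‖)
    (c₀ := n - 2 * ∑ p, (q p : ℝ) * s₀ p + 2 * ∑ p, par x p * ν p)
    (c := fun p => 2 * perp x p) hq
    (Kernel.integrable_of_increments (ae_abs_norm_perp_sub_le hτ hα haMax q)) (by
      intro s a hs
      have h1 := norm_perp_sq_next_sub_le (q := q) (a := a) hs.1 hν
      rw [hs.sum_mul_eq hs₀, ← hx] at h1
      have h2 : ∑ p, 2 * perp x p * a p =
          2 * ∑ p, (q p : ℝ) * a p - 2 * ∑ p, par x p * a p := by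
        rw [Finset.mul_sum, Finset.mul_sum, ← Finset.sum_sub_distrib]
        refine Finset.sum_congr rfl fun p _ => ?_
        rw [perp, PiLp.sub_apply, hxq]; ring
      rw [h2, ← hx]; linarith)
  rw [← hx] at h hq ⊢
  refine h.trans (add_le_add_right (div_le_div_of_nonneg_right ?_ (by positivity)) _)
  obtain ⟨Z, hZ⟩ : ∃ Z, Z = ‖perp x‖ := ⟨_, rfl⟩
  rw [← hZ] at hq ⊢
  obtain ⟨c, hc⟩ : ∃ c, c = minEntry ν / Z := ⟨_, rfl⟩
  have hc0 : 0 < c := by rw [hc]; positivity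
  have hcZ : c * Z = minEntry ν := by rw [hc]; field_simp
  have h1 : ∑ p, 2 * perp x p * arrivalMean α p = 2 * (1 - ε) * ∑ p, perp x p * ν p := by
    rw [Finset.mul_sum]
    refine Finset.sum_congr rfl fun p _ => ?_
    rw [hmean, PiLp.smul_apply, smul_eq_mul]; ring
  -- The test array is ν pushed by length ν_min in the direction of q_⊥: its entries stay
  -- nonnegative as no entry of q_⊥ exceeds Z in size, and its row and column sums do not exceed 1.
  have h2 := hs₀.sum_mul_le (r := fun p => ν p + c * perp x p) (fun p => by
      have h3 : |perp x p| ≤ Z := by rw [hZ]; exact PiLp.norm_apply_le (perp x) p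
      nlinarith [mul_le_mul_of_nonneg_left (neg_le_of_abs_le h3) hc0.le, minEntry_le ν p])
    (fun i => by
      rw [Finset.sum_add_distrib, ← Finset.mul_sum, hν.2.1]
      nlinarith [sum_row_perp_le_zero x i])
    (fun j => by
      rw [Finset.sum_add_distrib, ← Finset.mul_sum, hν.2.2]
      nlinarith [sum_col_perp_le_zero x j])
  have h4 : ∑ p, (q p : ℝ) * (ν p + c * perp x p) = ∑ p, (q p : ℝ) * ν p + minEntry ν * Z := by
    have h5 := inner_self_perp x
    rw [inner_eq_sum, ← hZ] at h5
    have h6 : ∑ p, (q p : ℝ) * (ν p + c * perp x p) =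
        ∑ p, (q p : ℝ) * ν p + c * ∑ p, x p * perp x p := by
      rw [Finset.mul_sum, ← Finset.sum_add_distrib]
      exact Finset.sum_congr rfl fun p _ => by rw [hxq]; ring
    rw [h6, h5, ← hcZ]; ring
  have h7 : ∑ p, (q p : ℝ) * ν p = ∑ p, par x p * ν p + ∑ p, perp x p * ν p := by
    rw [← Finset.sum_add_distrib]
    refine Finset.sum_congr rfl fun p _ => ?_
    rw [perp, PiLp.sub_apply, hxq]; ring
  have h8 : -(Z * ‖ν‖) ≤ ∑ p, perp x p * ν p := by
    rw [← inner_eq_sum, hZ]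
    exact neg_le_of_abs_le (abs_real_inner_le_norm _ _)
  rw [h4] at h2
  rw [h1]
  -- The gain 2 ν_min Z from the test array, minus the loss 2ε Z‖ν‖ ≤ ν_min Z, leaves the drift
  -- ν_min Z.
  nlinarith [mul_le_mul_of_nonneg_left h8 hε.le, mul_le_mul_of_nonneg_left hεν hq.le]

/-! ### Reaching the empty state -/

lemma IsArrivalLaw.arrivalLaw_zero_pos (hα : IsArrivalLaw α aMax) : 0 < arrivalLaw α {0} := by
  obtain ⟨δ, hδ, hp⟩ := hα.2
  rw [arrivalLaw, Measure.pi_singleton, pos_iff_ne_zero, Finset.prod_ne_zero_iff]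
  intro p _ h0
  have := hp p
  rw [measureReal_def, Pi.zero_apply] at *
  rw [h0, ENNReal.toReal_zero] at this
  linarith

/-- With positive probability nothing arrives, and then a MaxWeight schedule removes at least one
packet unless the switch is already empty. -/
lemma transition_sum_le_pos (hτ : IsMaxWeightRule τ) (hα : IsArrivalLaw α aMax) {q : Arr n}
    {m : ℕ} (hq : ∑ p, q p ≤ m + 1) : 0 < transition α τ q {u | ∑ p, u p ≤ m} := by
  rw [pos_iff_ne_zero]
  intro h0
  have h1 : ∀ᵐ y ∂transition α τ q, ¬∑ p, y p ≤ m := by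
    rw [ae_iff]; simpa using h0
  rw [transition_apply, ae_map_iff Measurable.of_discrete.aemeasurable
    MeasurableSet.of_discrete] at h1
  have h2 : ∀ᵐ z ∂(τ q : Measure (Arr n)).prod (arrivalLaw α), z.2 ∈ ({0}ᶜ : Set (Arr n)) := by
    filter_upwards [h1, hτ.ae_slot hα q] with z hz hz' h
    have hz2 : z.2 = 0 := h
    refine hz ?_
    rw [hz2]
    have hle : ∀ p, next q 0 z.1 p ≤ q p := fun p => by simp [next]
    by_cases hq0 : q = 0
    · refine (Finset.sum_le_sum fun p _ => hle p).trans ?_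
      simp [hq0]
    · obtain ⟨p, hp, hsp⟩ := hz'.1.exists_served hq0
      have : ∑ p, next q 0 z.1 p < ∑ p, q p :=
        Finset.sum_lt_sum (fun p _ => hle p) ⟨p, Finset.mem_univ p, by simp [next]; omega⟩
      omega
  have h3 := measurePreserving_snd (μ := (τ q : Measure (Arr n))) (ν := arrivalLaw α)
  have h4 : ∀ᵐ a ∂(arrivalLaw α), a ∈ ({0}ᶜ : Set (Arr n)) := by
    rw [← h3.map_eq, ae_map_iff h3.measurable.aemeasurable MeasurableSet.of_discrete]
    exact h2
  refine hα.arrivalLaw_zero_pos.ne' ?_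
  rw [ae_iff] at h4
  simpa using h4

/-- An empty switch can stay empty, so every time from the total queue length onwards is possible;
no separate aperiodicity argument is needed. -/
lemma transition_pow_zero_pos (hτ : IsMaxWeightRule τ) (hα : IsArrivalLaw α aMax) (m : ℕ)
    {q : Arr n} (hq : ∑ p, q p ≤ m) : 0 < ((transition α τ) ^ m) q {0} := by
  induction m generalizing q with
  | zero =>
    have hq0 : q = 0 := by
      funext p
      exact Finset.sum_eq_zero_iff.1 (Nat.le_zero.1 hq) p (Finset.mem_univ p)
    have e : ((transition α τ) ^ 0) q = Measure.dirac q := by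
      rw [pow_zero]; exact Kernel.id_apply q
    rw [e, hq0]; simp
  | succ m ih =>
    rw [add_comm, Kernel.pow_add_apply_eq_lintegral _ _ _ _ MeasurableSet.of_discrete, pow_one,
      lintegral_pos_iff_support Measurable.of_discrete]
    exact (transition_sum_le_pos hτ hα hq).trans_le (measure_mono fun u hu => (ih hu).ne')

/-! ### The law of the queue lengths -/

lemma queueLaw_eq_bind (μ : ProbabilityMeasure (Arr n)) (t : ℕ) :
    (queueLaw α τ μ t : Measure (Arr n)) =
      (μ : Measure (Arr n)).bind ((transition α τ) ^ t) := by
  induction t with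
  | zero =>
    rw [pow_zero]
    exact (Measure.bind_dirac).symm
  | succ t ih =>
    change (queueLaw α τ μ t : Measure (Arr n)).bind (transition α τ) = _
    rw [ih, Measure.comp_assoc, pow_succ']
    rfl

/-- Convergence from each starting point is averaged over the initial law by dominated convergence.
-/
lemma tendsto_queueLaw {π : ProbabilityMeasure (Arr n)}
    (h : ∀ (f : Arr n → ℝ) (C : ℝ), (∀ x, |f x| ≤ C) → ∀ x,
      Tendsto (fun t => ∫ y, f y ∂((transition α τ) ^ t) x) atTop
        (𝓝 (∫ y, f y ∂(π : Measure (Arr n)))))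
    (μ : ProbabilityMeasure (Arr n)) : Tendsto (queueLaw α τ μ) atTop (𝓝 π) := by
  rw [ProbabilityMeasure.tendsto_iff_forall_integral_tendsto]
  intro F
  have hF : ∀ x, |F x| ≤ ‖F‖ := fun x => F.norm_coe_le_norm x
  have hMk := Kernel.isMarkovKernel_pow (transition α τ)
  have e : ∀ t, ∫ y, F y ∂(queueLaw α τ μ t : Measure (Arr n)) =
      ∫ x, ∫ y, F y ∂((transition α τ) ^ t) x ∂(μ : Measure (Arr n)) := fun t => by
    have hi : Integrable F (queueLaw α τ μ t : Measure (Arr n)) :=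
      Kernel.integrable_of_abs_le hF
    rw [queueLaw_eq_bind] at hi ⊢
    exact Kernel.integral_bind hi
  simp_rw [e]
  have h2 : ∫ y, F y ∂(π : Measure (Arr n)) =
      ∫ _, ∫ y, F y ∂(π : Measure (Arr n)) ∂(μ : Measure (Arr n)) := by simp
  rw [h2]
  exact tendsto_integral_of_dominated_convergence (fun _ => ‖F‖)
    (fun t => Measurable.of_discrete.aestronglyMeasurable) (integrable_const _)
    (fun t => ae_of_all _ fun x => Kernel.abs_integral_le_of_abs_le hF)
    (ae_of_all _ fun x => h F ‖F‖ hF x)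

lemma finite_norm_le (M : ℝ) : {q : Arr n | ‖toVec q‖ ≤ M}.Finite := by
  refine (Set.finite_Iic (fun _ => ⌊M⌋₊ : Arr n)).subset fun q hq p => ?_
  refine Nat.le_floor ?_
  have h1 : ‖toVec q p‖ ≤ ‖toVec q‖ := PiLp.norm_apply_le _ p
  rw [toVec_apply, Real.norm_of_nonneg (Nat.cast_nonneg _)] at h1
  exact h1.trans hq

/-- The switch is positive recurrent for rates in the interior of the capacity region. -/
theorem exists_stationary (hn : 0 < n) (hτ : IsMaxWeightRule τ) (hα : IsArrivalLaw α aMax)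
    (haMax : 1 ≤ aMax) {ν : Vec n} (hν : ν ∈ face n) (hνpos : 0 < minEntry ν) {ε : ℝ} (hε : 0 < ε)
    (hmean : arrivalMean α = (1 - ε) • ν) :
    ∃ π : ProbabilityMeasure (Arr n),
      (transition α τ).Invariant (π : Measure (Arr n)) ∧
      Integrable (fun q => ‖toVec q‖) (π : Measure (Arr n)) ∧
      ∀ μ : ProbabilityMeasure (Arr n), Tendsto (queueLaw α τ μ) atTop (𝓝 π) := by
  have hn' : (0 : ℝ) < n := by exact_mod_cast hn
  have hD : 0 < n * aMax := by positivity
  have hεν : 0 < ε * minEntry ν := by positivity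
  obtain ⟨B, hB⟩ : ∃ B, B = ‖arrivalMean α‖ ^ 2 + ‖arrivalStd α‖ ^ 2 + n := ⟨_, rfl⟩
  have hB0 : 0 < B := by rw [hB]; positivity
  -- Above B / (ε ν_min) the term B cancels at most half of the drift 2ε ν_min ‖q‖; after division
  -- by 2‖q‖ there remains ε ν_min / 2.
  obtain ⟨θ, γ, K, hθ, hγ0, hγ1, hK, hexp⟩ := Kernel.exists_exp_drift (κ := transition α τ)
    (Z := fun q => ‖toVec q‖) (η := ε * minEntry ν / 2) (k₀ := B / (ε * minEntry ν)) hD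
    (by positivity) (fun q => ae_abs_norm_sub_le hτ hα haMax q) (fun q hq => by
      have hq0 : 0 < ‖toVec q‖ := lt_of_lt_of_le (by positivity) hq
      have h1 := integral_norm_le hτ hα haMax hν hνpos hε hmean hq0
      rw [← hB] at h1
      refine h1.trans ?_
      rw [sub_eq_add_neg]
      refine add_le_add_right ?_ _
      rw [div_le_iff₀ (by positivity)]
      rw [div_le_iff₀ hεν] at hq
      nlinarith)
  obtain ⟨π, hinv, hint, hconv⟩ := Kernel.exists_invariant_tendsto (κ := transition α τ)
    (V := fun q => Real.exp (θ * ‖toVec q‖)) 0 hγ0 hγ1 hK (fun _ => (Real.exp_pos _).le)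
    (fun M => (finite_norm_le (M / θ)).subset fun q hq => by
      change ‖toVec q‖ ≤ M / θ
      have hq' : Real.exp (θ * ‖toVec q‖) ≤ M := hq
      rw [le_div_iff₀ hθ]
      linarith [Real.add_one_le_exp (θ * ‖toVec q‖)])
    (fun q => (hexp q).1) (fun q => (hexp q).2)
    (fun q => eventually_atTop.2 ⟨∑ p, q p, fun m hm => transition_pow_zero_pos hτ hα m hm⟩)
  refine ⟨π, hinv, ?_, tendsto_queueLaw hconv⟩
  refine (hint.div_const θ).mono' Measurable.of_discrete.aestronglyMeasurable
    (ae_of_all _ fun q => ?_)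
  rw [norm_norm, le_div_iff₀ hθ]
  linarith [Real.add_one_le_exp (θ * ‖toVec q‖)]

/-! ### The moments -/

lemma minEntry_le_one (hn : 0 < n) {ν : Vec n} (hν : ν ∈ face n) : minEntry ν ≤ 1 := by
  refine (minEntry_le ν (⟨0, hn⟩, ⟨0, hn⟩)).trans ?_
  rw [← hν.2.1 ⟨0, hn⟩]
  exact Finset.single_le_sum (f := fun j => ν (⟨0, hn⟩, j)) (fun j _ => hν.1 _)
    (Finset.mem_univ _)

/-- The moments obtained from geometric tails are below the constant of the theorem. -/
lemma moment_le_momentBound_pow {ν lam σ : Vec n} (hn : 0 < n) (haMax : 1 ≤ aMax)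
    (hνpos : 0 < minEntry ν) (hν1 : minEntry ν ≤ 1) {r : ℕ} (hr : 1 ≤ r) :
    2 ^ (r - 1) * ((2 * (‖lam‖ ^ 2 + ‖σ‖ ^ 2 + n) / minEntry ν) ^ r + (2 * (n * aMax)) ^ r *
      (r.factorial * (1 / (1 - n * aMax / (n * aMax + minEntry ν / 4)) ^ r))) ≤
      momentBound ν lam σ aMax r ^ r := by
  have hn' : (0 : ℝ) < n := by exact_mod_cast hn
  have hr0 : r ≠ 0 := by omega
  obtain ⟨D, hD⟩ : ∃ D, D = n * aMax := ⟨_, rfl⟩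
  have hD0 : 0 < D := by rw [hD]; positivity
  obtain ⟨v, hv⟩ : ∃ v, v = minEntry ν := ⟨_, rfl⟩
  obtain ⟨B, hB⟩ : ∃ B, B = ‖lam‖ ^ 2 + ‖σ‖ ^ 2 + n := ⟨_, rfl⟩
  have hB0 : 0 < B := by rw [hB]; positivity
  obtain ⟨A, hA⟩ : ∃ A, A = 8 * B / v := ⟨_, rfl⟩
  obtain ⟨Y, hY⟩ : ∃ Y, Y = (√r * Real.exp 1) ^ (1 / (r : ℝ)) * (16 * (r / Real.exp 1)) *
        (D / v) * (D + 1) := ⟨_, rfl⟩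
  rw [momentBound, ← hD, ← hv, ← hB, ← hA, ← hY]
  rw [← hv] at hνpos hν1
  have hA0 : 0 ≤ A := by rw [hA]; positivity
  have hY0 : 0 ≤ Y := by rw [hY]; positivity
  have hroot : ∀ x : ℝ, 0 ≤ x → (x ^ (1 / (r : ℝ))) ^ r = x := fun x hx => by
    rw [one_div, Real.rpow_inv_natCast_pow hx hr0]
  rw [mul_pow ((2 : ℝ) ^ (1 / (r : ℝ))), hroot 2 zero_le_two]
  have h2r : (2 : ℝ) ^ (r - 1) ≤ 2 ^ r := pow_le_pow_right₀ one_le_two (by omega)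
  have h1 : 2 ^ (r - 1) * (2 * B / v) ^ r ≤ A ^ r := by
    calc 2 ^ (r - 1) * (2 * B / v) ^ r ≤ 2 ^ r * (2 * B / v) ^ r := by gcongr
      _ = (4 * B / v) ^ r := by rw [← mul_pow]; congr 1; ring
      _ ≤ A ^ r := by
        rw [hA]
        gcongr
        norm_num
  have h2 : 2 ^ (r - 1) * ((2 * D) ^ r * (r.factorial * (1 / (1 - D / (D + v / 4)) ^ r))) ≤
      Y ^ r := by
    have e1 : 1 - D / (D + v / 4) = (v / 4) / (D + v / 4) := by field_simp; ring
    have e2 : (1 : ℝ) / (1 - D / (D + v / 4)) ^ r = ((D + v / 4) / (v / 4)) ^ r := by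
      rw [e1, ← one_div_pow, one_div_div]
    rw [e2]
    calc 2 ^ (r - 1) * ((2 * D) ^ r * (r.factorial * ((D + v / 4) / (v / 4)) ^ r))
        ≤ 2 ^ r * ((2 * D) ^ r * (r.factorial * ((D + v / 4) / (v / 4)) ^ r)) := by gcongr
      _ = r.factorial * (16 * (D / v) * (D + v / 4)) ^ r := by
          -- The 16 is 2 from convexity, 2 from the level spacing 2D, and 4 from η = v/4. Then v/4 ≤
          -- 1 replaces D + v/4 by D + 1.
          have e3 : 16 * (D / v) * (D + v / 4) = 2 * (2 * D) * ((D + v / 4) / (v / 4)) := by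
            field_simp; ring
          rw [e3, mul_pow (2 * (2 * D)), mul_pow 2 (2 * D)]; ring
      _ ≤ (√r * Real.exp 1 * (r / Real.exp 1) ^ r) * (16 * (D / v) * (D + 1)) ^ r := by
          gcongr
          · exact Nat.factorial_le_stirling hr
          · linarith
      _ = Y ^ r := by
          have e4 : Y = (√r * Real.exp 1) ^ (1 / (r : ℝ)) *
              ((r / Real.exp 1) * (16 * (D / v) * (D + 1))) := by rw [hY]; ring
          rw [e4, mul_pow ((√r * Real.exp 1) ^ (1 / (r : ℝ))), hroot _ (by positivity),
            mul_pow (r / Real.exp 1)]; ring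
  have h3 : A ^ r ≤ max A Y ^ r := pow_le_pow_left₀ hA0 (le_max_left _ _) r
  -- Bounding both summands by the same maximum costs the factor 2, which is why 2^(1/r) stands in
  -- M_r.
  have h4 : Y ^ r ≤ max A Y ^ r := pow_le_pow_left₀ hY0 (le_max_right _ _) r
  rw [mul_add]
  linarith

theorem moment_perp_le (hn : 0 < n) (hτ : IsMaxWeightRule τ) (hα : IsArrivalLaw α aMax)
    (haMax : 1 ≤ aMax) {ν : Vec n} (hν : ν ∈ face n) (hνpos : 0 < minEntry ν) {ε : ℝ} (hε : 0 < ε)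
    (hεν : ε * ‖ν‖ ≤ minEntry ν / 2) (hmean : arrivalMean α = (1 - ε) • ν)
    {π : ProbabilityMeasure (Arr n)} (hinv : (transition α τ).Invariant (π : Measure (Arr n)))
    (hint : Integrable (fun q => ‖toVec q‖) (π : Measure (Arr n))) {r : ℕ} (hr : 1 ≤ r) :
    Integrable (fun q => ‖perp (toVec q)‖ ^ r) (π : Measure (Arr n)) ∧
      ∫ q, ‖perp (toVec q)‖ ^ r ∂(π : Measure (Arr n)) ≤
        momentBound ν (arrivalMean α) (arrivalStd α) aMax r ^ r := by
  have hn' : (0 : ℝ) < n := by exact_mod_cast hn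
  have hD : 0 < n * aMax := by positivity
  obtain ⟨B, hB⟩ : ∃ B, B = ‖arrivalMean α‖ ^ 2 + ‖arrivalStd α‖ ^ 2 + n := ⟨_, rfl⟩
  have hB0 : 0 < B := by rw [hB]; positivity
  have hZi : Integrable (fun q => ‖perp (toVec q)‖) (π : Measure (Arr n)) :=
    hint.mono' Measurable.of_discrete.aestronglyMeasurable (ae_of_all _ fun q => by
      rw [norm_norm]; exact norm_perp_le _)
  -- Above 2B / ν_min the term B uses at most half of ν_min ‖q_⊥‖, so dividing by 2‖q_⊥‖ leaves η =
  -- ν_min / 4.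
  have htail := Kernel.tail_le hinv (Z := fun q => ‖perp (toVec q)‖) (η := minEntry ν / 4)
    (k₀ := 2 * B / minEntry ν) hD (by positivity) hZi
    (fun q => ae_abs_norm_perp_sub_le hτ hα haMax q) (fun q hq => by
      have hq0 : 0 < ‖perp (toVec q)‖ := lt_of_lt_of_le (by positivity) hq
      have h1 := integral_norm_perp_le hτ hα haMax hν hνpos hε hεν hmean hq0
      rw [← hB] at h1
      refine h1.trans ?_
      rw [sub_eq_add_neg]
      refine add_le_add_right ?_ _
      rw [div_le_iff₀ (by positivity)]
      rw [div_le_iff₀ hνpos] at hq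
      nlinarith)
  obtain ⟨hi, hle⟩ := integral_pow_le_of_geometric_tail (fun q => norm_nonneg (perp (toVec q))) hD
    (by positivity) (by positivity) (by rw [div_lt_one (by positivity)]; linarith) htail hr
  refine ⟨hi, hle.trans ?_⟩
  rw [hB]
  exact moment_le_momentBound_pow hn haMax hνpos (minEntry_le_one hn hν) hr

end Transitions

end InputQueuedSwitch

/-! ### Assembly of the theorem -/

open InputQueuedSwitch in
theorem proposition2 (n : ℕ) (hn : 0 < n)
    (ν : Vec n) (hν : ν ∈ face n) (hνpos : 0 < minEntry ν)
    (aMax : ℝ) (haMax : 1 ≤ aMax)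
    (α : ℝ → Fin n × Fin n → ProbabilityMeasure ℕ)
    (hα : ∀ ε : ℝ, 0 < ε → ε < 1 →
      IsArrivalLaw (α ε) aMax ∧ arrivalMean (α ε) = (1 - ε) • ν)
    (τ : Arr n → ProbabilityMeasure (Arr n)) (hτ : IsMaxWeightRule τ) :
    (∀ ε : ℝ, 0 < ε → ε < 1 →
      ∃ π : ProbabilityMeasure (Arr n),
        (transition (α ε) τ).Invariant (π : Measure (Arr n)) ∧
        (∀ μ : ProbabilityMeasure (Arr n),
          Tendsto (queueLaw (α ε) τ μ) atTop (𝓝 π)) ∧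
        (ε ≤ minEntry ν / (2 * ‖ν‖) → ∀ r : ℕ, 1 ≤ r →
          Integrable (fun q => ‖perp (toVec q)‖ ^ r) (π : Measure (Arr n)) ∧
          ∫ q, ‖perp (toVec q)‖ ^ r ∂(π : Measure (Arr n)) ≤
            momentBound ν (arrivalMean (α ε)) (arrivalStd (α ε)) aMax r ^ r)) ∧
    ∀ r : ℕ, 1 ≤ r → ∃ C : ℝ, ∀ ε : ℝ, 0 < ε → ε < 1 →
      ε ≤ minEntry ν / (2 * ‖ν‖) →
      momentBound ν (arrivalMean (α ε)) (arrivalStd (α ε)) aMax r ≤ C := by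
  refine ⟨fun ε hε hε1 => ?_, fun r hr => ?_⟩
  · obtain ⟨hαε, hmean⟩ := hα ε hε hε1
    obtain ⟨π, hinv, hint, hconv⟩ := exists_stationary hn hτ hαε haMax hν hνpos hε hmean
    refine ⟨π, hinv, hconv, fun hεν r hr => ?_⟩
    have hνn : 0 < ‖ν‖ := by
      have h := PiLp.norm_apply_le ν (⟨0, hn⟩, ⟨0, hn⟩)
      have h2 := hνpos.trans_le (minEntry_le ν (⟨0, hn⟩, ⟨0, hn⟩))
      exact (h2.trans_le (Real.le_norm_self _)).trans_le h
    refine moment_perp_le hn hτ hαε haMax hν hνpos hε ?_ hmean hinv hint hr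
    rw [le_div_iff₀ (by positivity)] at hεν
    linarith
  -- The arrival law enters M_r only through ‖λ‖² + ‖σ‖², here replaced by its bound (n·aMax)².
  · refine ⟨(2 : ℝ) ^ (1 / (r : ℝ)) * max (8 * ((n * aMax) ^ 2 + n) / minEntry ν)
      ((√r * Real.exp 1) ^ (1 / (r : ℝ)) * (16 * (r / Real.exp 1)) *
        (n * aMax / minEntry ν) * (n * aMax + 1)), fun ε hε hε1 _ => ?_⟩
    have h := (hα ε hε hε1).1.norm_sq_add_norm_sq_le
    unfold momentBound
    gcongr
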